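/- **Theorem (Integer-affine denominator method).** For a word $\alpha=((r_1,s_1),\ldots,(r_d,s_d))$, $d\ge 0$, of letters with powers $r_j\in\{1,2,\ldots\}$ and colors $s_j\in\mathbb C$, and for an integer $N\ge 0$, put $$\mathcal H_\alpha(N)=\sum_{N\ge n_1>\cdots>n_d\ge 1}\ \prod_{j=1}^d\frac{s_j^{n_j}}{n_j^{r_j}},\qquad \mathcal H_\emptyset(N)=1 .$$ If the limit exists, $\mathrm{Li}_{r_1,\ldots,r_d}(s_1,\ldots,s_d)=\lim_{N\to\infty}\mathcal H_\alpha(N)$ is called the multiple polylogarithm value with arguments $s_1,\ldots,s_d$; the empty word gives the value $1$. Let $p,a,b,q\ge 1$ be integers, let $z\in\mathbb C$, let $\alpha_1,\ldots,\alpha_m$ $(m\ge 0)$ be such words, let $e_1,\ldots,e_m\ge 0$ be integers, and put $A_N=\prod_{j=1}^m\mathcal H_{\alpha_j}(N)^{e_j}$. Let $K\subset\mathbb C$ be the field generated over $\mathbb Q$ by $z$ and all colors occurring in $\alpha_1,\ldots,\alpha_m$. Suppose that the series $$S=\sum_{n=1}^\infty \frac{z^nA_{pn}}{(an+b)^q}$$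 converges (as a limit of partial sums, not necessarily absolutely). Then $S$ is a finite linear combination $$S=\sum_{i=1}^{L}c_i\,\mathrm{Li}_{\mathbf r_i}(\mathbf s_i)$$ of (convergent) multiple polylogarithm values with positive integer weights, where all coefficients $c_i\in\mathbb C$ and all entries of the arguments $\mathbf s_i$ are algebraic over $K$. In particular, if $z$ and all colors occurring in the $\alpha_j$ are algebraic numbers, then all $c_i$ and all entries of the $\mathbf s_i$ are algebraic numbers. -/

import Mathlib

open Filter Topology

/-- A word in colored letters `(r, s)`: the power `r` is a positive integer, the color `s` is a
complex number. The empty list is the empty word. -/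
abbrev ColoredWord : Type := List (ℕ+ × ℂ)

/-- The colored multiple harmonic number
`∑_{N ≥ n₁ > ⋯ > n_d ≥ 1} ∏ j, s_j ^ n_j / n_j ^ r_j` of the word `((r₁, s₁), …, (r_d, s_d))`,
organised by the outermost index `n₁ = k + 1`, the remaining indices being at most `k`.
It is `1` for the empty word. -/
noncomputable def multipleHarmonic : ColoredWord → ℕ → ℂ
  | [], _ => 1
  | (r, s) :: w, N =>
      ∑ k ∈ Finset.range N, s ^ (k + 1) / ((k + 1 : ℕ) : ℂ) ^ (r : ℕ) * multipleHarmonic w k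

/-- `v` is the value `Li_{r₁, …, r_d}(s₁, …, s_d) = ∑_{n₁ > ⋯ > n_d ≥ 1} ∏ j, s_j ^ n_j / n_j ^ r_j`
of the (convergent) multiple polylogarithm attached to the word, that is, the limit of the
multiple harmonic numbers. The value of the empty word is `1`. -/
def IsMultiplePolylogValue (w : ColoredWord) (v : ℂ) : Prop :=
  Tendsto (multipleHarmonic w) atTop (𝓝 v)

/-- The product `A_N = ∏ j, H_{α_j}(N) ^ e_j`. -/
noncomputable def harmonicProduct {m : ℕ} (α : Fin m → ColoredWord) (e : Fin m → ℕ) (N : ℕ) : ℂ :=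
  ∏ j, multipleHarmonic (α j) N ^ e j

/-- The subfield of `ℂ` generated over `ℚ` by `z` and the colors of the words `α_j`. -/
noncomputable def parameterField {m : ℕ} (z : ℂ) (α : Fin m → ColoredWord) :
    IntermediateField ℚ ℂ :=
  IntermediateField.adjoin ℚ ({z} ∪ {s : ℂ | ∃ j, ∃ l ∈ α j, l.2 = s})

/-!
The sum `S` is the boundary value at `1` of a power series, and the proof computes it by analytic
continuation; this avoids all questions about which of the individual nested sums converge.

*The generating function.* Stuffle products turn `A_N` into a combination of multiple harmonic
numbers. Placing the `n`-th term at the index `a p n + b p = p (a n + b)` makes its denominator a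
power of the index, so the generating function arises by repeated integration against `dx / x`.
Roots of unity select the indices in the arithmetic progression, and integration by parts shows
that polynomial multiples of hyperlogarithms are stable under this integration
(`divIndex_shiftSeq_mem`). Hence the generating function is a combination of hyperlogarithms with
polynomial coefficients near `0` (`spreadSeq_mem_hyperSeqSpan`, `exists_generatingFunction`). All
data lie in the algebraic closure `F` of the parameter field.

*The ring of constants.* Let `R` be the `F`-span of the polylogarithm values with colours in `F`
all of whose prefix products have modulus less than `1`. These series converge geometrically, `R`
is a ring by the stuffle product, and `R` contains the values of hyperlogarithms with letters in
`F` at points of `F` inside the disc of convergence (`hyperlog_mem_strictRing`).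

*Continuation.* Hyperlogarithms satisfy differential equations `G' = g / (x - a)`. Integrating
these from a new base point of `F` rewrites hyperlogarithms at one base point as combinations of
hyperlogarithms at another; the integration constants are values, hence lie in `R`
(`exists_eqOn_hyperlog`). The unit disc without the finitely many singularities is connected, so
the generating function has such a representation at every point of `F` in it
(`exists_mem_polySpan_of_mem_ball`). From a rational base point near `1` the same argument leads to
expansions in powers of `log (1 - x)` and hyperlogarithms based at the singular point `1`.

*The limit.* By Abel's theorem the generating function tends to the sum of the series as `x`
increases to `1`. Near `1` it is asymptotic to a polynomial in a logarithm that tends to infinity,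
so this polynomial is constant, and its constant coefficient lies in `R` (`mem_of_tendsto_sum`).
-/

/-! ### Nested sums in prefix form -/

/-- Coefficients of the hyperlogarithm series of a word in *prefix form*. A letter `(r, τ)` stands
for the exponent `r + 1` together with the product `τ` of all colours up to and including that
position, so that the series of `v` is
`∑_{n₁ > ⋯ > n_d ≥ 1} τ₁ ^ (n₁ - n₂) ⋯ τ_d ^ n_d / ∏ n_j ^ (r_j + 1) * u ^ n₁`.
In this form removing the first letter does not alter the remaining ones, and the singularities
of the series are `0` and the `τ_j⁻¹`. -/
noncomputable def hyperCoeff : List (ℕ × ℂ) → ℕ → ℂ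
  | [], n => if n = 0 then 1 else 0
  | (r, τ) :: v, n =>
      (∑ k ∈ Finset.range n, τ ^ (n - k) * hyperCoeff v k) / (n : ℂ) ^ (r + 1)

@[simp] lemma hyperCoeff_nil_zero : hyperCoeff [] 0 = 1 := by simp [hyperCoeff]

@[simp] lemma hyperCoeff_nil_succ (n : ℕ) : hyperCoeff [] (n + 1) = 0 := by simp [hyperCoeff]

@[simp] lemma hyperCoeff_cons_zero (l : ℕ × ℂ) (v : List (ℕ × ℂ)) :
    hyperCoeff (l :: v) 0 = 0 := by
  obtain ⟨r, τ⟩ := l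
  simp [hyperCoeff]

lemma natCast_mul_hyperCoeff_succ (r : ℕ) (τ : ℂ) (v : List (ℕ × ℂ)) (n : ℕ) :
    (n : ℂ) * hyperCoeff ((r + 1, τ) :: v) n = hyperCoeff ((r, τ) :: v) n := by
  rcases Nat.eq_zero_or_pos n with rfl | hn
  · simp
  · have : (n : ℂ) ≠ 0 := by exact_mod_cast hn.ne'
    simp only [hyperCoeff]
    field_simp
    ring

lemma natCast_mul_hyperCoeff_zero (τ : ℂ) (v : List (ℕ × ℂ)) (n : ℕ) :
    (n : ℂ) * hyperCoeff ((0, τ) :: v) n =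
      ∑ k ∈ Finset.range n, τ ^ (n - k) * hyperCoeff v k := by
  rcases Nat.eq_zero_or_pos n with rfl | hn
  · simp
  · have : (n : ℂ) ≠ 0 := by exact_mod_cast hn.ne'
    simp only [hyperCoeff]
    field_simp
    ring

/-- The recursion behind `(1 - τ u) L' = τ L_v` for the series `L` of `(0, τ) :: v`. -/
lemma succ_mul_hyperCoeff_zero (τ : ℂ) (v : List (ℕ × ℂ)) (n : ℕ) :
    ((n + 1 : ℕ) : ℂ) * hyperCoeff ((0, τ) :: v) (n + 1) =
      τ * (n * hyperCoeff ((0, τ) :: v) n + hyperCoeff v n) := by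
  rw [natCast_mul_hyperCoeff_zero, natCast_mul_hyperCoeff_zero, Finset.sum_range_succ, mul_add,
    Finset.mul_sum]
  congr 1
  · refine Finset.sum_congr rfl fun k hk => ?_
    rw [Nat.succ_sub (Finset.mem_range.1 hk).le, pow_succ]
    ring
  · simp

/-- The prefix form of a coloured word, with all prefix products multiplied by `t`. -/
def prefixWord : ℂ → ColoredWord → List (ℕ × ℂ)
  | _, [] => []
  | t, (r, s) :: w => (r.natPred, t * s) :: prefixWord (t * s) w

lemma hyperCoeff_map_mul (c : ℂ) (v : List (ℕ × ℂ)) (n : ℕ) :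
    hyperCoeff (v.map fun l => (l.1, c * l.2)) n = c ^ n * hyperCoeff v n := by
  induction v generalizing n with
  | nil => cases n <;> simp
  | cons l v ih =>
    obtain ⟨r, τ⟩ := l
    simp only [List.map_cons, hyperCoeff, ih]
    rw [← mul_div_assoc, Finset.mul_sum]
    congr 1
    refine Finset.sum_congr rfl fun k hk => ?_
    have : c ^ n = c ^ (n - k) * c ^ k := by
      rw [← pow_add, Nat.sub_add_cancel (Finset.mem_range.1 hk).le]
    rw [this, mul_pow]
    ring

lemma prefixWord_mul (c t : ℂ) (w : ColoredWord) :
    prefixWord (c * t) w = (prefixWord t w).map fun l => (l.1, c * l.2) := by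
  induction w generalizing t with
  | nil => rfl
  | cons l w ih =>
    obtain ⟨r, s⟩ := l
    simp only [prefixWord, List.map_cons, mul_assoc]
    rw [ih]

lemma hyperCoeff_prefixWord (t : ℂ) (w : ColoredWord) (n : ℕ) :
    hyperCoeff (prefixWord t w) n = t ^ n * hyperCoeff (prefixWord 1 w) n := by
  conv_lhs => rw [← mul_one t, prefixWord_mul, hyperCoeff_map_mul]

/-- Multiple harmonic numbers are the partial sums at `1` of the hyperlogarithm series. -/
lemma multipleHarmonic_eq_sum (w : ColoredWord) (N : ℕ) :
    multipleHarmonic w N = ∑ n ∈ Finset.range (N + 1), hyperCoeff (prefixWord 1 w) n := by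
  induction w generalizing N with
  | nil => simp [multipleHarmonic, prefixWord, Finset.sum_range_succ']
  | cons l w ih =>
    obtain ⟨r, s⟩ := l
    rw [Finset.sum_range_succ']
    simp only [multipleHarmonic, prefixWord, hyperCoeff_cons_zero, add_zero]
    refine Finset.sum_congr rfl fun k _ => ?_
    rw [ih, hyperCoeff, PNat.natPred_add_one, one_mul, div_mul_eq_mul_div, Finset.mul_sum]
    congr 1
    refine Finset.sum_congr rfl fun i hi => ?_
    rw [hyperCoeff_prefixWord s, ← mul_assoc, ← pow_add,
      Nat.sub_add_cancel (Finset.mem_range.1 hi).le]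

lemma mul_multipleHarmonic_eq_sum (s : ℂ) (w : ColoredWord) (n : ℕ) :
    s ^ (n + 1) * multipleHarmonic w n =
      ((n + 1 : ℕ) : ℂ) * hyperCoeff ((0, s) :: prefixWord s w) (n + 1) := by
  rw [natCast_mul_hyperCoeff_zero, multipleHarmonic_eq_sum, Finset.mul_sum]
  refine Finset.sum_congr rfl fun i hi => ?_
  rw [hyperCoeff_prefixWord s, ← mul_assoc, ← pow_add,
    Nat.sub_add_cancel (Finset.mem_range.1 hi).le]

lemma summable_norm_hyperCoeff {v : List (ℕ × ℂ)} {ρ : ℝ} (hρ : 0 ≤ ρ)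
    (hv : ∀ l ∈ v, ‖l.2‖ * ρ < 1) : Summable fun n => ‖hyperCoeff v n‖ * ρ ^ n := by
  induction v with
  | nil =>
    refine summable_of_ne_finset_zero (s := {0}) fun n hn => ?_
    obtain ⟨m, rfl⟩ := Nat.exists_eq_succ_of_ne_zero (by simpa using hn)
    simp
  | cons l v ih =>
    obtain ⟨r, τ⟩ := l
    have h1 : Summable fun n => (‖τ‖ * ρ) ^ n :=
      summable_geometric_of_lt_one (by positivity) (hv (r, τ) List.mem_cons_self)
    have h2 := ih fun l hl => hv l (by simp [hl])
    have h3 := summable_norm_sum_mul_range_of_summable_norm (f := fun n => ‖hyperCoeff v n‖ * ρ ^ n)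
      (g := fun n => (‖τ‖ * ρ) ^ n) h2.norm h1.norm
    refine Summable.of_nonneg_of_le (fun n => by positivity) (fun n => ?_) h3
    rcases Nat.eq_zero_or_pos n with rfl | hn
    · simp
    have hn1 : (1 : ℝ) ≤ (n : ℝ) ^ (r + 1) := one_le_pow₀ (by exact_mod_cast hn)
    calc ‖hyperCoeff ((r, τ) :: v) n‖ * ρ ^ n
        ≤ (∑ k ∈ Finset.range n, ‖τ ^ (n - k) * hyperCoeff v k‖) * ρ ^ n := by
          gcongr
          rw [hyperCoeff, norm_div, norm_pow, Complex.norm_natCast]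
          exact (div_le_self (norm_nonneg _) hn1).trans (norm_sum_le _ _)
      _ = ∑ k ∈ Finset.range n, ‖hyperCoeff v k‖ * ρ ^ k * (‖τ‖ * ρ) ^ (n - k) := by
          rw [Finset.sum_mul]
          refine Finset.sum_congr rfl fun k hk => ?_
          have : ρ ^ n = ρ ^ (n - k) * ρ ^ k := by
            rw [← pow_add, Nat.sub_add_cancel (Finset.mem_range.1 hk).le]
          rw [this, mul_pow, norm_mul, norm_pow]
          ring
      _ ≤ ∑ k ∈ Finset.range (n + 1), ‖hyperCoeff v k‖ * ρ ^ k * (‖τ‖ * ρ) ^ (n - k) :=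
          Finset.sum_le_sum_of_subset_of_nonneg (by simp) fun _ _ _ => by positivity
      _ ≤ _ := Real.le_norm_self _

/-! ### The stuffle product -/

/-- The words, with multiplicity, of the stuffle (quasi-shuffle) product of two coloured words. -/
def stuffle : ColoredWord → ColoredWord → List ColoredWord
  | [], v => [v]
  | l :: u, [] => [l :: u]
  | (r, s) :: u, (r', s') :: v =>
      (stuffle u ((r', s') :: v)).map (List.cons (r, s)) ++
        ((stuffle ((r, s) :: u) v).map (List.cons (r', s')) ++
          (stuffle u v).map (List.cons (r + r', s * s')))
  termination_by u v => u.length + v.length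

lemma sum_map_cons_multipleHarmonic_succ (r : ℕ+) (s : ℂ) (L : List ColoredWord) (N : ℕ) :
    ((L.map (List.cons (r, s))).map fun w => multipleHarmonic w (N + 1)).sum =
      ((L.map (List.cons (r, s))).map fun w => multipleHarmonic w N).sum +
        s ^ (N + 1) / ((N + 1 : ℕ) : ℂ) ^ (r : ℕ) *
          (L.map fun w => multipleHarmonic w N).sum := by
  induction L with
  | nil => simp
  | cons w L ih =>
    simp only [List.map_cons, List.sum_cons, ih]
    rw [multipleHarmonic, Finset.sum_range_succ, multipleHarmonic]
    ring

lemma sum_map_cons_multipleHarmonic_zero (r : ℕ+) (s : ℂ) (L : List ColoredWord) :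
    ((L.map (List.cons (r, s))).map fun w => multipleHarmonic w 0).sum = 0 := by
  induction L with
  | nil => simp
  | cons w L ih => simpa [multipleHarmonic] using ih

theorem multipleHarmonic_mul (u v : ColoredWord) (N : ℕ) :
    multipleHarmonic u N * multipleHarmonic v N =
      ((stuffle u v).map fun w => multipleHarmonic w N).sum := by
  match u, v with
  | [], v => simp [stuffle, multipleHarmonic]
  | l :: u, [] => simp [stuffle, multipleHarmonic]
  | (r, s) :: u, (r', s') :: v =>
    have h1 := multipleHarmonic_mul u ((r', s') :: v)
    have h2 := multipleHarmonic_mul ((r, s) :: u) v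
    have h3 := multipleHarmonic_mul u v
    rw [stuffle]
    simp only [List.map_append, List.sum_append]
    induction N with
    | zero =>
      simp only [sum_map_cons_multipleHarmonic_zero]
      simp [multipleHarmonic]
    | succ N ih =>
      simp only [sum_map_cons_multipleHarmonic_succ]
      rw [← h1 N, ← h2 N, ← h3 N]
      have e1 : multipleHarmonic ((r, s) :: u) (N + 1) = multipleHarmonic ((r, s) :: u) N +
          s ^ (N + 1) / ((N + 1 : ℕ) : ℂ) ^ (r : ℕ) * multipleHarmonic u N := by
        rw [multipleHarmonic, Finset.sum_range_succ, multipleHarmonic]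
      have e2 : multipleHarmonic ((r', s') :: v) (N + 1) = multipleHarmonic ((r', s') :: v) N +
          s' ^ (N + 1) / ((N + 1 : ℕ) : ℂ) ^ (r' : ℕ) * multipleHarmonic v N := by
        rw [multipleHarmonic, Finset.sum_range_succ, multipleHarmonic]
      rw [e1, e2, PNat.add_coe, mul_pow, pow_add (_ : ℂ) (r : ℕ), ← div_mul_div_comm]
      linear_combination ih
  termination_by u.length + v.length

/-- A multiplicatively closed condition on colours passes to the stuffle product. -/
lemma colors_stuffle {P : ℂ → Prop} (hP : ∀ x y, P x → P y → P (x * y)) {u v : ColoredWord}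
    (hu : ∀ l ∈ u, P l.2) (hv : ∀ l ∈ v, P l.2) : ∀ w ∈ stuffle u v, ∀ l ∈ w, P l.2 := by
  match u, v with
  | [], v => simpa [stuffle] using hv
  | l :: u, [] =>
    rw [stuffle]
    exact fun w hw => (List.mem_singleton.1 hw) ▸ hu
  | (r, s) :: u, (r', s') :: v =>
    have hu' : ∀ l ∈ u, P l.2 := fun l hl => hu l (List.mem_cons_of_mem _ hl)
    have hv' : ∀ l ∈ v, P l.2 := fun l hl => hv l (List.mem_cons_of_mem _ hl)
    have hs : P s := hu (r, s) List.mem_cons_self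
    have hs' : P s' := hv (r', s') List.mem_cons_self
    have h1 := colors_stuffle hP hu' hv
    have h2 := colors_stuffle hP hu hv'
    have h3 := colors_stuffle hP hu' hv'
    intro w hw
    rw [stuffle] at hw
    simp only [List.mem_append, List.mem_map] at hw
    rcases hw with ⟨w, hw, rfl⟩ | ⟨w, hw, rfl⟩ | ⟨w, hw, rfl⟩ <;> intro l hl <;>
      rcases List.mem_cons.1 hl with rfl | hl
    · exact hs
    · exact h1 w hw l hl
    · exact hs'
    · exact h2 w hw l hl
    · exact hP _ _ hs hs'
    · exact h3 w hw l hl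
  termination_by u.length + v.length

/-- Words all of whose prefix products have modulus less than `1` are closed under stuffles: a
prefix of a stuffle is a stuffle of prefixes. -/
lemma norm_prefixWord_stuffle {t t' : ℂ} (ht : ‖t‖ ≤ 1) (ht' : ‖t'‖ ≤ 1) {u v : ColoredWord}
    (hu : ∀ l ∈ prefixWord t u, ‖l.2‖ < 1) (hv : ∀ l ∈ prefixWord t' v, ‖l.2‖ < 1) :
    ∀ w ∈ stuffle u v, ∀ l ∈ prefixWord (t * t') w, ‖l.2‖ < 1 := by
  have aux : ∀ {c x : ℂ} {w : ColoredWord}, ‖c‖ ≤ 1 → (∀ l ∈ prefixWord x w, ‖l.2‖ < 1) →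
      ∀ l ∈ prefixWord (c * x) w, ‖l.2‖ < 1 := by
    intro c x w hc hw l hl
    rw [prefixWord_mul, List.mem_map] at hl
    obtain ⟨l, hl, rfl⟩ := hl
    rw [norm_mul]
    exact mul_lt_one_of_nonneg_of_lt_one_right hc (norm_nonneg _) (hw l hl)
  match u, v with
  | [], v => simpa [stuffle] using aux ht hv
  | l :: u, [] =>
    rw [mul_comm]
    simpa [stuffle] using aux ht' hu
  | (r, s) :: u, (r', s') :: v =>
    have hs : ‖t * s‖ < 1 := hu (r.natPred, t * s) (by simp [prefixWord])
    have hs' : ‖t' * s'‖ < 1 := hv (r'.natPred, t' * s') (by simp [prefixWord])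
    have hu' : ∀ l ∈ prefixWord (t * s) u, ‖l.2‖ < 1 := fun l hl => hu l (by simp [prefixWord, hl])
    have hv' : ∀ l ∈ prefixWord (t' * s') v, ‖l.2‖ < 1 :=
      fun l hl => hv l (by simp [prefixWord, hl])
    have h1 := norm_prefixWord_stuffle hs.le ht' hu' hv
    have h2 := norm_prefixWord_stuffle ht hs'.le hu hv'
    have h3 := norm_prefixWord_stuffle hs.le hs'.le hu' hv'
    intro w hw
    rw [stuffle] at hw
    simp only [List.mem_append, List.mem_map] at hw
    rcases hw with ⟨w, hw, rfl⟩ | ⟨w, hw, rfl⟩ | ⟨w, hw, rfl⟩ <;> intro l hl <;>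
      rcases List.mem_cons.1 hl with rfl | hl
    · rw [show t * t' * s = (t * s) * t' by ring, norm_mul]
      exact mul_lt_one_of_nonneg_of_lt_one_left (norm_nonneg _) hs ht'
    · rw [show t * t' * s = (t * s) * t' by ring] at hl
      exact h1 w hw l hl
    · rw [show t * t' * s' = t * (t' * s') by ring, norm_mul]
      exact mul_lt_one_of_nonneg_of_lt_one_right ht (norm_nonneg _) hs'
    · rw [show t * t' * s' = t * (t' * s') by ring] at hl
      exact h2 w hw l hl
    · rw [show t * t' * (s * s') = (t * s) * (t' * s') by ring, norm_mul]
      exact mul_lt_one_of_nonneg_of_lt_one_left (norm_nonneg _) hs hs'.le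
    · rw [show t * t' * (s * s') = (t * s) * (t' * s') by ring] at hl
      exact h3 w hw l hl
  termination_by u.length + v.length

/-! ### The ring of strictly convergent values -/

/-- Values of words with colours in `F` all of whose prefix products have modulus less than `1`;
their series converge geometrically. -/
def strictValues (F : Subfield ℂ) : Set ℂ :=
  {x | ∃ w : ColoredWord, (∀ l ∈ w, l.2 ∈ F) ∧ (∀ l ∈ prefixWord 1 w, ‖l.2‖ < 1) ∧
    IsMultiplePolylogValue w x}

lemma isMultiplePolylogValue_tsum {w : ColoredWord} (hw : ∀ l ∈ prefixWord 1 w, ‖l.2‖ < 1) :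
    IsMultiplePolylogValue w (∑' n, hyperCoeff (prefixWord 1 w) n) := by
  have h : Summable fun n => hyperCoeff (prefixWord 1 w) n := by
    have := summable_norm_hyperCoeff (v := prefixWord 1 w) zero_le_one (by simpa using hw)
    exact Summable.of_norm (by simpa using this)
  have h' := (h.hasSum.tendsto_sum_nat).comp (tendsto_add_atTop_nat 1)
  refine h'.congr fun N => ?_
  rw [multipleHarmonic_eq_sum]
  rfl

lemma one_mem_strictValues (F : Subfield ℂ) : (1 : ℂ) ∈ strictValues F :=
  ⟨[], by simp, by simp [prefixWord], tendsto_const_nhds⟩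

lemma mul_mem_span_strictValues (F : Subfield ℂ) {x y : ℂ} (hx : x ∈ strictValues F)
    (hy : y ∈ strictValues F) : x * y ∈ Submodule.span F (strictValues F) := by
  obtain ⟨u, hu1, hu2, hu3⟩ := hx
  obtain ⟨v, hv1, hv2, hv3⟩ := hy
  have hc := colors_stuffle (P := (· ∈ F)) (fun _ _ => F.mul_mem) hu1 hv1
  have hn : ∀ w ∈ stuffle u v, ∀ l ∈ prefixWord 1 w, ‖l.2‖ < 1 := by
    simpa using norm_prefixWord_stuffle (t := 1) (t' := 1) (by simp) (by simp) hu2 hv2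
  have key : ∀ L : List ColoredWord, (∀ w ∈ L, ∀ l ∈ w, l.2 ∈ F) →
      (∀ w ∈ L, ∀ l ∈ prefixWord 1 w, ‖l.2‖ < 1) →
      ∃ a ∈ Submodule.span F (strictValues F),
        Tendsto (fun N => (L.map fun w => multipleHarmonic w N).sum) atTop (𝓝 a) := by
    intro L
    induction L with
    | nil => exact fun _ _ => ⟨0, zero_mem _, by simp⟩
    | cons w L ih =>
      intro h1 h2
      obtain ⟨a, ha, hL⟩ := ih (fun w hw => h1 w (List.mem_cons_of_mem _ hw))
        (fun w hw => h2 w (List.mem_cons_of_mem _ hw))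
      have hw := isMultiplePolylogValue_tsum (h2 w List.mem_cons_self)
      exact ⟨_, add_mem (Submodule.subset_span
        ⟨w, h1 w List.mem_cons_self, h2 w List.mem_cons_self, hw⟩) ha,
        by simpa using Tendsto.add hw hL⟩
  obtain ⟨a, ha, hlim⟩ := key _ hc hn
  have : Tendsto (fun N => multipleHarmonic u N * multipleHarmonic v N) atTop (𝓝 (x * y)) :=
    Tendsto.mul hu3 hv3
  rw [tendsto_nhds_unique this (hlim.congr fun N => (multipleHarmonic_mul u v N).symm)]
  exact ha

/-- The `F`-linear combinations of strictly convergent values; they form a ring because of the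
stuffle product. -/
noncomputable def strictRing (F : Subfield ℂ) : Subalgebra F ℂ :=
  (Submodule.span F (strictValues F)).toSubalgebra
    (Submodule.subset_span (one_mem_strictValues F)) fun x y hx hy => by
      have h := Submodule.mul_mem_mul hx hy
      rw [Submodule.span_mul_span] at h
      refine Submodule.span_le.2 ?_ h
      rintro _ ⟨x, hx, y, hy, rfl⟩
      exact mul_mem_span_strictValues F hx hy

lemma mem_strictRing {F : Subfield ℂ} {x : ℂ} :
    x ∈ strictRing F ↔ x ∈ Submodule.span F (strictValues F) := Iff.rfl

lemma exists_prefixWord_eq {F : Subfield ℂ} {t : ℂ} (ht : t ∈ F) (ht0 : t ≠ 0)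
    {v : List (ℕ × ℂ)} (hv : ∀ l ∈ v, l.2 ∈ F ∧ l.2 ≠ 0) :
    ∃ w : ColoredWord, (∀ l ∈ w, l.2 ∈ F) ∧ prefixWord t w = v := by
  induction v generalizing t with
  | nil => exact ⟨[], by simp, rfl⟩
  | cons l v ih =>
    obtain ⟨r, τ⟩ := l
    obtain ⟨hτ, hτ0⟩ := hv (r, τ) List.mem_cons_self
    obtain ⟨w, hw, hwv⟩ := ih hτ hτ0 fun l hl => hv l (List.mem_cons_of_mem _ hl)
    refine ⟨(r.succPNat, t⁻¹ * τ) :: w, ?_, ?_⟩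
    · rintro l (_ | ⟨_, hl⟩)
      · exact F.mul_mem (F.inv_mem ht) hτ
      · exact hw l hl
    · rw [prefixWord, mul_inv_cancel_left₀ ht0, hwv, Nat.natPred_succPNat]

/-- The sum of the hyperlogarithm series of a word in prefix form. -/
noncomputable def hyperlog (v : List (ℕ × ℂ)) (u : ℂ) : ℂ := ∑' n, hyperCoeff v n * u ^ n

lemma hyperlog_zero (v : List (ℕ × ℂ)) : hyperlog v 0 = hyperCoeff v 0 := by
  rw [hyperlog, tsum_eq_single 0]
  · simp
  · intro n hn
    simp [hn]

lemma hyperlog_nil (u : ℂ) : hyperlog [] u = 1 := by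
  rw [hyperlog, tsum_eq_single 0]
  · simp
  · intro n hn
    obtain ⟨m, rfl⟩ := Nat.exists_eq_succ_of_ne_zero hn
    simp

lemma hyperlog_zero_mem (R : Subring ℂ) (v : List (ℕ × ℂ)) : hyperlog v 0 ∈ R := by
  rw [hyperlog_zero]
  cases v with
  | nil => simp
  | cons l v => simp

/-- Hyperlogarithms evaluated at a point of `F` inside the disc of convergence are strictly
convergent values. -/
lemma hyperlog_mem_strictRing {F : Subfield ℂ} {v : List (ℕ × ℂ)}
    (hv : ∀ l ∈ v, l.2 ∈ F ∧ l.2 ≠ 0) {u : ℂ} (hu : u ∈ F) (hvu : ∀ l ∈ v, ‖l.2 * u‖ < 1) :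
    hyperlog v u ∈ strictRing F := by
  by_cases hu0 : u = 0
  · subst hu0
    exact hyperlog_zero_mem (strictRing F).toSubring v
  obtain ⟨w, hw, rfl⟩ := exists_prefixWord_eq (F.inv_mem hu) (inv_ne_zero hu0) hv
  refine mem_strictRing.2 (Submodule.subset_span ⟨w, hw, ?_, ?_⟩)
  · have := prefixWord_mul u u⁻¹ w
    rw [mul_inv_cancel₀ hu0] at this
    intro l hl
    rw [this, List.mem_map] at hl
    obtain ⟨l, hl, rfl⟩ := hl
    simpa [mul_comm] using hvu l hl
  · have h1 : hyperlog (prefixWord u⁻¹ w) u = ∑' n, hyperCoeff (prefixWord 1 w) n := by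
      refine tsum_congr fun n => ?_
      rw [hyperCoeff_prefixWord, mul_right_comm, ← mul_pow, inv_mul_cancel₀ hu0, one_pow, one_mul]
    rw [h1]
    refine isMultiplePolylogValue_tsum ?_
    have := prefixWord_mul u u⁻¹ w
    rw [mul_inv_cancel₀ hu0] at this
    intro l hl
    rw [this, List.mem_map] at hl
    obtain ⟨l, hl, rfl⟩ := hl
    simpa [mul_comm] using hvu l hl

/-! ### Differential equations of hyperlogarithms -/

lemma hasSum_of_forall_eq {f g : ℕ → ℂ} {a : ℂ} (hg : HasSum g a) (h : ∀ n, f n = g n) :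
    HasSum f a := (funext h : f = g) ▸ hg

lemma exists_radius {v : List (ℕ × ℂ)} {u : ℂ} (hv : ∀ l ∈ v, ‖l.2‖ * ‖u‖ < 1) :
    ∃ ρ : ℝ, ‖u‖ < ρ ∧ ∀ l ∈ v, ‖l.2‖ * ρ < 1 := by
  have h : ∀ᶠ ρ in 𝓝[>] ‖u‖, ∀ l ∈ v.toFinset, ‖l.2‖ * ρ < 1 := by
    rw [Filter.eventually_all_finset]
    intro l hl
    have hc : Tendsto (fun ρ : ℝ => ‖l.2‖ * ρ) (𝓝[>] ‖u‖) (𝓝 (‖l.2‖ * ‖u‖)) :=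
      ((continuous_const.mul continuous_id).tendsto _).mono_left nhdsWithin_le_nhds
    exact hc.eventually_lt_const (hv l (List.mem_toFinset.1 hl))
  obtain ⟨ρ, h1, h2⟩ := (h.and self_mem_nhdsWithin).exists
  exact ⟨ρ, h2, fun l hl => h1 l (List.mem_toFinset.2 hl)⟩

lemma hasSum_hyperlog {v : List (ℕ × ℂ)} {u : ℂ} (hv : ∀ l ∈ v, ‖l.2‖ * ‖u‖ < 1) :
    HasSum (fun n => hyperCoeff v n * u ^ n) (hyperlog v u) := by
  refine (Summable.of_norm ?_).hasSum
  simpa using summable_norm_hyperCoeff (norm_nonneg u) hv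

lemma hyperlog_differentiableAt_and_hasSum_deriv {v : List (ℕ × ℂ)} {u : ℂ}
    (hv : ∀ l ∈ v, ‖l.2‖ * ‖u‖ < 1) :
    DifferentiableAt ℂ (hyperlog v) u ∧
      HasSum (fun n : ℕ => (n : ℂ) * hyperCoeff v n * u ^ (n - 1)) (deriv (hyperlog v) u) := by
  obtain ⟨ρ, hu, hρ⟩ := exists_radius hv
  have hsum := summable_norm_hyperCoeff ((norm_nonneg u).trans hu.le) hρ
  have hd : ∀ n, DifferentiableOn ℂ (fun w => hyperCoeff v n * w ^ n) (Metric.ball 0 ρ) :=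
    fun n => by fun_prop
  have hle : ∀ (n : ℕ) (w : ℂ), w ∈ Metric.ball (0 : ℂ) ρ →
      ‖hyperCoeff v n * w ^ n‖ ≤ ‖hyperCoeff v n‖ * ρ ^ n := by
    intro n w hw
    rw [norm_mul, norm_pow]
    gcongr
    simpa using (mem_ball_zero_iff.1 hw).le
  have hmem : u ∈ Metric.ball (0 : ℂ) ρ := mem_ball_zero_iff.2 hu
  refine ⟨(Complex.differentiableOn_tsum_of_summable_norm hsum hd Metric.isOpen_ball hle
    ).differentiableAt (Metric.isOpen_ball.mem_nhds hmem), ?_⟩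
  have := Complex.hasSum_deriv_of_summable_norm hsum hd Metric.isOpen_ball hle hmem
  refine hasSum_of_forall_eq this fun n => ?_
  simp
  ring

lemma mul_deriv_hyperlog_succ {r : ℕ} {τ : ℂ} {v : List (ℕ × ℂ)} {u : ℂ}
    (hv : ∀ l ∈ (r, τ) :: v, ‖l.2‖ * ‖u‖ < 1) :
    u * deriv (hyperlog ((r + 1, τ) :: v)) u = hyperlog ((r, τ) :: v) u := by
  have hv' : ∀ l ∈ (r + 1, τ) :: v, ‖l.2‖ * ‖u‖ < 1 := by
    simpa using hv
  have h := (hyperlog_differentiableAt_and_hasSum_deriv hv').2.mul_left u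
  refine h.unique (hasSum_of_forall_eq (hasSum_hyperlog hv) fun n => ?_)
  rw [← natCast_mul_hyperCoeff_succ r τ v n]
  rcases Nat.eq_zero_or_pos n with rfl | hn
  · simp
  · rw [mul_left_comm, mul_pow_sub_one hn.ne']

lemma deriv_hyperlog_zero {τ : ℂ} {v : List (ℕ × ℂ)} {u : ℂ}
    (hv : ∀ l ∈ (0, τ) :: v, ‖l.2‖ * ‖u‖ < 1) :
    deriv (hyperlog ((0, τ) :: v)) u =
      τ * (u * deriv (hyperlog ((0, τ) :: v)) u + hyperlog v u) := by
  have h := (hyperlog_differentiableAt_and_hasSum_deriv hv).2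
  have h1 := (hasSum_nat_add_iff' 1).2 h
  have h2 := ((h.mul_left u).add
    (hasSum_hyperlog fun l hl => hv l (List.mem_cons_of_mem _ hl))).mul_left τ
  rw [Finset.sum_range_one, Nat.cast_zero, zero_mul, zero_mul, sub_zero] at h1
  refine h1.unique (hasSum_of_forall_eq h2 fun n => ?_)
  rw [succ_mul_hyperCoeff_zero, Nat.add_sub_cancel]
  rcases Nat.eq_zero_or_pos n with rfl | hn
  · simp
  · rw [mul_left_comm u, mul_pow_sub_one hn.ne']
    ring

/-- The words whose hyperlogarithm based at `c` has all its singularities `c + τ⁻¹` in `A`.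
Exponents above `1` (positive first components) introduce the form `dx / (x - c)`, so `c` must
then belong to `A` as well. -/
def Admissible (A : Set ℂ) (c : ℂ) (v : List (ℕ × ℂ)) : Prop :=
  ∀ l ∈ v, l.2 ≠ 0 ∧ c + l.2⁻¹ ∈ A ∧ (l.1 = 0 ∨ c ∈ A)

/-- The point `x` is closer to `c` than every point of `A` other than `c`. -/
def InDisc (A : Set ℂ) (c x : ℂ) : Prop := ∀ a ∈ A, a ≠ c → ‖x - c‖ < ‖a - c‖

lemma Admissible.of_cons {A : Set ℂ} {c : ℂ} {l : ℕ × ℂ} {v : List (ℕ × ℂ)}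
    (h : Admissible A c (l :: v)) : Admissible A c v :=
  fun m hm => h m (List.mem_cons_of_mem _ hm)

lemma Admissible.mono {A B : Set ℂ} {c : ℂ} {v : List (ℕ × ℂ)} (hAB : A ⊆ B)
    (h : Admissible A c v) : Admissible B c v :=
  fun l hl => ⟨(h l hl).1, hAB (h l hl).2.1, (h l hl).2.2.imp_right fun hc => hAB hc⟩

lemma admissible_nil (A : Set ℂ) (c : ℂ) : Admissible A c [] := by simp [Admissible]

lemma Admissible.norm_lt {A : Set ℂ} {c x : ℂ} {v : List (ℕ × ℂ)} (h : Admissible A c v)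
    (hx : InDisc A c x) : ∀ l ∈ v, ‖l.2‖ * ‖x - c‖ < 1 := by
  intro l hl
  obtain ⟨h0, h1, -⟩ := h l hl
  have := hx _ h1 (by simpa using h0)
  rw [add_sub_cancel_left, norm_inv] at this
  calc ‖l.2‖ * ‖x - c‖ < ‖l.2‖ * ‖l.2‖⁻¹ := by
        have := norm_pos_iff.2 h0
        gcongr
    _ = 1 := mul_inv_cancel₀ (norm_ne_zero_iff.2 h0)

lemma Admissible.differentiableAt {A : Set ℂ} {c x : ℂ} {v : List (ℕ × ℂ)}
    (h : Admissible A c v) (hx : InDisc A c x) :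
    DifferentiableAt ℂ (fun x => hyperlog v (x - c)) x := by
  have := (hyperlog_differentiableAt_and_hasSum_deriv (h.norm_lt hx)).1
  exact this.comp x (differentiableAt_id.sub_const c)

lemma Admissible.hasDerivAt_succ {A : Set ℂ} {c x : ℂ} {r : ℕ} {τ : ℂ} {v : List (ℕ × ℂ)}
    (h : Admissible A c ((r, τ) :: v)) (hx : InDisc A c x) (hxc : x ≠ c) :
    HasDerivAt (fun x => hyperlog ((r + 1, τ) :: v) (x - c))
      (hyperlog ((r, τ) :: v) (x - c) / (x - c)) x := by
  have hn := h.norm_lt hx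
  have hn' : ∀ l ∈ (r + 1, τ) :: v, ‖l.2‖ * ‖x - c‖ < 1 := by simpa using hn
  have hd := (hyperlog_differentiableAt_and_hasSum_deriv hn').1.hasDerivAt
  rw [← mul_deriv_hyperlog_succ hn, mul_div_cancel_left₀ _ (sub_ne_zero.2 hxc)]
  exact hd.comp_sub_const x c

lemma Admissible.hasDerivAt_zero {A : Set ℂ} {c x : ℂ} {τ : ℂ} {v : List (ℕ × ℂ)}
    (h : Admissible A c ((0, τ) :: v)) (hx : InDisc A c x) :
    HasDerivAt (fun x => hyperlog ((0, τ) :: v) (x - c))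
      (-(hyperlog v (x - c) / (x - (c + τ⁻¹)))) x := by
  have hn := h.norm_lt hx
  obtain ⟨h0, h1, -⟩ := h _ List.mem_cons_self
  have hd := (hyperlog_differentiableAt_and_hasSum_deriv hn).1.hasDerivAt
  have hne : x - (c + τ⁻¹) ≠ 0 := by
    intro h2
    have := hx _ h1 (by simpa using h0)
    rw [sub_eq_zero.1 h2] at this
    exact lt_irrefl _ this
  have e : deriv (hyperlog ((0, τ) :: v)) (x - c) =
      -(hyperlog v (x - c) / (x - (c + τ⁻¹))) := by
    rw [← neg_div, eq_div_iff hne]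
    have := deriv_hyperlog_zero hn
    have hτ : τ⁻¹ * deriv (hyperlog ((0, τ) :: v)) (x - c) =
        (x - c) * deriv (hyperlog ((0, τ) :: v)) (x - c) + hyperlog v (x - c) := by
      rw [inv_mul_eq_iff_eq_mul₀ h0]
      exact this
    linear_combination -hτ
  rw [← e]
  exact hd.comp_sub_const x c

/-! ### Change of base point -/

section BasePoint

variable {R : Subring ℂ}

/-- The functions in `M` have primitives in `M`, on `Ω`, for the forms `g dx / (x - a)`, `a ∈ A`. -/
def PrimitiveClosed (A Ω : Set ℂ) (M : Submodule R (ℂ → ℂ)) : Prop :=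
  ∀ g ∈ M, ∀ a ∈ A, ∃ G ∈ M, ∀ x ∈ Ω, HasDerivAt G (g x / (x - a)) x

lemma primitiveClosed_span {A Ω : Set ℂ} {s : Set (ℂ → ℂ)}
    (h : ∀ g ∈ s, ∀ a ∈ A, ∃ G ∈ Submodule.span R s, ∀ x ∈ Ω, HasDerivAt G (g x / (x - a)) x) :
    PrimitiveClosed A Ω (Submodule.span R s) := by
  intro g hg a ha
  induction hg using Submodule.span_induction with
  | mem g hg => exact h g hg a ha
  | zero => exact ⟨0, zero_mem _, fun x _ => by simp⟩
  | add g₁ g₂ _ _ h₁ h₂ =>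
    obtain ⟨G₁, hG₁, H₁⟩ := h₁
    obtain ⟨G₂, hG₂, H₂⟩ := h₂
    refine ⟨G₁ + G₂, add_mem hG₁ hG₂, fun x hx => ?_⟩
    rw [Pi.add_apply, add_div]
    exact (H₁ x hx).add (H₂ x hx)
  | smul c g _ h =>
    obtain ⟨G, hG, H⟩ := h
    refine ⟨c • G, Submodule.smul_mem _ _ hG, fun x hx => ?_⟩
    have := (H x hx).const_mul (c : ℂ)
    rw [← mul_div_assoc] at this
    exact this

lemma const_mem {M : Submodule R (ℂ → ℂ)} (h1 : (fun _ => 1) ∈ M) {c : ℂ} (hc : c ∈ R) :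
    (fun _ => c) ∈ M := by
  have := M.smul_mem (⟨c, hc⟩ : R) h1
  convert this using 1
  ext x
  simp [Subring.smul_def]

lemma exists_eqOn_of_hasDerivAt {A Ω : Set ℂ} {M : Submodule R (ℂ → ℂ)} (hΩ : IsOpen Ω)
    (hΩ' : IsPreconnected Ω) {y : ℂ} (hy : y ∈ Ω) (h1 : (fun _ => 1) ∈ M)
    (hM : PrimitiveClosed A Ω M) (hval : ∀ g ∈ M, g y ∈ R) {f g : ℂ → ℂ} (hg : g ∈ M) {a : ℂ}
    (ha : a ∈ A) (hf : ∀ x ∈ Ω, HasDerivAt f (g x / (x - a)) x) (hfy : f y ∈ R) :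
    ∃ G ∈ M, Set.EqOn f G Ω := by
  obtain ⟨G, hG, hGd⟩ := hM g hg a ha
  refine ⟨G + fun _ => (f y - G y), add_mem hG (const_mem h1 (R.sub_mem hfy (hval G hG))), ?_⟩
  have hGd' : ∀ x ∈ Ω, HasDerivAt (G + fun _ => (f y - G y)) (g x / (x - a)) x :=
    fun x hx => (hGd x hx).add_const _
  refine hΩ.eqOn_of_deriv_eq hΩ' (fun x hx => (hf x hx).differentiableAt.differentiableWithinAt)
    (fun x hx => (hGd' x hx).differentiableAt.differentiableWithinAt)
    (fun x hx => by rw [(hf x hx).deriv, (hGd' x hx).deriv]) hy ?_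
  simp

/-- Hyperlogarithms based at `c` lie locally in every module of functions that contains the
constants of `R` and is closed under the relevant primitives: this is integration of the
differential equations, the integration constants being the values at `y`. -/
theorem exists_eqOn_hyperlog {A Ω : Set ℂ} {M : Submodule R (ℂ → ℂ)} (hΩ : IsOpen Ω)
    (hΩ' : IsPreconnected Ω) {y c : ℂ} (hy : y ∈ Ω) (h1 : (fun _ => 1) ∈ M)
    (hM : PrimitiveClosed A Ω M) (hval : ∀ g ∈ M, g y ∈ R) (hA : ∀ x ∈ Ω, x ∉ A)
    (hc : ∀ x ∈ Ω, InDisc A c x) (hcv : ∀ v, Admissible A c v → hyperlog v (y - c) ∈ R)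
    {v : List (ℕ × ℂ)} (hv : Admissible A c v) :
    ∃ g ∈ M, Set.EqOn (fun x => hyperlog v (x - c)) g Ω := by
  induction v with
  | nil => exact ⟨_, h1, fun x _ => hyperlog_nil _⟩
  | cons l v ih =>
    obtain ⟨r, τ⟩ := l
    induction r with
    | zero =>
      obtain ⟨g, hg, hgv⟩ := ih hv.of_cons
      refine exists_eqOn_of_hasDerivAt hΩ hΩ' hy h1 hM hval (neg_mem hg)
        (hv _ List.mem_cons_self).2.1 (fun x hx => ?_) (hcv _ hv)
      have := hv.hasDerivAt_zero (hc x hx)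
      rw [Pi.neg_apply, neg_div, ← hgv hx]
      exact this
    | succ r ihr =>
      have hcA : c ∈ A := (hv _ List.mem_cons_self).2.2.resolve_left (Nat.succ_ne_zero r)
      have hv' : Admissible A c ((r, τ) :: v) := by
        intro l hl
        rcases List.mem_cons.1 hl with rfl | hl
        · exact ⟨(hv _ List.mem_cons_self).1, (hv _ List.mem_cons_self).2.1, Or.inr hcA⟩
        · exact hv l (List.mem_cons_of_mem _ hl)
      obtain ⟨g, hg, hgv⟩ := ihr hv'
      refine exists_eqOn_of_hasDerivAt hΩ hΩ' hy h1 hM hval hg hcA (fun x hx => ?_) (hcv _ hv)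
      rw [← hgv hx]
      exact hv'.hasDerivAt_succ (hc x hx) fun h => hA x hx (h ▸ hcA)

variable (R) in
/-- The `R`-combinations of hyperlogarithms based at `c` with singularities in `A`. -/
def hyperModule (A : Set ℂ) (c : ℂ) : Submodule R (ℂ → ℂ) :=
  Submodule.span R {f | ∃ v, Admissible A c v ∧ f = fun x => hyperlog v (x - c)}

lemma hyperlog_mem_hyperModule {A : Set ℂ} {c : ℂ} {v : List (ℕ × ℂ)} (hv : Admissible A c v) :
    (fun x => hyperlog v (x - c)) ∈ hyperModule R A c := Submodule.subset_span ⟨v, hv, rfl⟩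

lemma one_mem_hyperModule (A : Set ℂ) (c : ℂ) : (fun _ => 1) ∈ hyperModule R A c := by
  have := hyperlog_mem_hyperModule (R := R) (admissible_nil A c)
  simpa only [hyperlog_nil] using this

lemma apply_self_mem_of_mem_hyperModule {A : Set ℂ} {c : ℂ} {g : ℂ → ℂ}
    (hg : g ∈ hyperModule R A c) : g c ∈ R := by
  induction hg using Submodule.span_induction with
  | mem g hg =>
    obtain ⟨v, -, rfl⟩ := hg
    change hyperlog v (c - c) ∈ R
    rw [sub_self]
    exact hyperlog_zero_mem R v
  | zero => exact R.zero_mem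
  | add g₁ g₂ _ _ h₁ h₂ => exact R.add_mem h₁ h₂
  | smul a g _ h => exact R.mul_mem a.2 h

lemma differentiableAt_of_mem_hyperModule {A : Set ℂ} {c x : ℂ} {g : ℂ → ℂ}
    (hg : g ∈ hyperModule R A c) (hx : InDisc A c x) : DifferentiableAt ℂ g x := by
  induction hg using Submodule.span_induction with
  | mem g hg =>
    obtain ⟨v, hv, rfl⟩ := hg
    exact hv.differentiableAt hx
  | zero => exact differentiableAt_const 0
  | add g₁ g₂ _ _ h₁ h₂ => exact h₁.add h₂
  | smul a g _ h => exact h.const_smul a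

lemma Admissible.cons_zero {A : Set ℂ} {c a : ℂ} {v : List (ℕ × ℂ)} (hv : Admissible A c v)
    (ha : a ∈ A) (hac : a ≠ c) : Admissible A c ((0, (a - c)⁻¹) :: v) := by
  intro l hl
  rcases List.mem_cons.1 hl with rfl | hl
  · exact ⟨inv_ne_zero (sub_ne_zero.2 hac), by simpa using ha, Or.inl rfl⟩
  · exact hv l hl

lemma Admissible.hasDerivAt_cons_zero {A : Set ℂ} {c a x : ℂ} {v : List (ℕ × ℂ)}
    (hv : Admissible A c v) (ha : a ∈ A) (hac : a ≠ c) (hx : InDisc A c x) :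
    HasDerivAt (-fun x => hyperlog ((0, (a - c)⁻¹) :: v) (x - c))
      (hyperlog v (x - c) / (x - a)) x := by
  have := ((hv.cons_zero ha hac).hasDerivAt_zero hx).neg
  rwa [neg_neg, inv_inv, add_sub_cancel] at this

lemma primitiveClosed_hyperModule {A Ω : Set ℂ} {c : ℂ} (hc : c ∉ A)
    (hΩ : ∀ x ∈ Ω, InDisc A c x) : PrimitiveClosed A Ω (hyperModule R A c) := by
  refine primitiveClosed_span ?_
  rintro _ ⟨v, hv, rfl⟩ a ha
  have hac : a ≠ c := fun h => hc (h ▸ ha)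
  exact ⟨_, neg_mem (hyperlog_mem_hyperModule (hv.cons_zero ha hac)),
    fun x hx => hv.hasDerivAt_cons_zero ha hac (hΩ x hx)⟩

/-- The combinations of functions of `M` with polynomial coefficients. -/
def polySpan (M : Submodule R (ℂ → ℂ)) : Submodule R (ℂ → ℂ) :=
  Submodule.span R {f | ∃ m : ℕ, ∃ g ∈ M, f = fun x => x ^ m * g x}

lemma exists_mem_polySpan_eqOn {M M' : Submodule R (ℂ → ℂ)} {s : Set (ℂ → ℂ)} {Ω : Set ℂ}
    (hM : M = Submodule.span R s) (h : ∀ g ∈ s, ∃ g' ∈ M', Set.EqOn g g' Ω) {f : ℂ → ℂ}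
    (hf : f ∈ polySpan M) : ∃ g ∈ polySpan M', Set.EqOn f g Ω := by
  have h' : ∀ g ∈ M, ∃ g' ∈ M', Set.EqOn g g' Ω := by
    intro g hg
    rw [hM] at hg
    induction hg using Submodule.span_induction with
    | mem g hg => exact h g hg
    | zero => exact ⟨0, zero_mem _, fun x _ => rfl⟩
    | add g₁ g₂ _ _ h₁ h₂ =>
      obtain ⟨G₁, hG₁, H₁⟩ := h₁
      obtain ⟨G₂, hG₂, H₂⟩ := h₂
      exact ⟨_, add_mem hG₁ hG₂, fun x hx => congrArg₂ (· + ·) (H₁ hx) (H₂ hx)⟩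
    | smul c g _ h =>
      obtain ⟨G, hG, H⟩ := h
      exact ⟨_, Submodule.smul_mem _ c hG, fun x hx => congrArg (c • ·) (H hx)⟩
  induction hf using Submodule.span_induction with
  | mem f hf =>
    obtain ⟨m, g, hg, rfl⟩ := hf
    obtain ⟨G, hG, H⟩ := h' g hg
    exact ⟨_, Submodule.subset_span ⟨m, G, hG, rfl⟩, fun x hx => congrArg (x ^ m * ·) (H hx)⟩
  | zero => exact ⟨0, zero_mem _, fun x _ => rfl⟩
  | add g₁ g₂ _ _ h₁ h₂ =>
    obtain ⟨G₁, hG₁, H₁⟩ := h₁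
    obtain ⟨G₂, hG₂, H₂⟩ := h₂
    exact ⟨_, add_mem hG₁ hG₂, fun x hx => congrArg₂ (· + ·) (H₁ hx) (H₂ hx)⟩
  | smul c g _ h =>
    obtain ⟨G, hG, H⟩ := h
    exact ⟨_, Submodule.smul_mem _ c hG, fun x hx => congrArg (c • ·) (H hx)⟩

lemma differentiableAt_of_mem_polySpan {M : Submodule R (ℂ → ℂ)} {x : ℂ}
    (hM : ∀ g ∈ M, DifferentiableAt ℂ g x) {f : ℂ → ℂ} (hf : f ∈ polySpan M) :
    DifferentiableAt ℂ f x := by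
  induction hf using Submodule.span_induction with
  | mem g hg =>
    obtain ⟨m, g, hg, rfl⟩ := hg
    exact (differentiableAt_pow m).mul (hM g hg)
  | zero => exact differentiableAt_const 0
  | add g₁ g₂ _ _ h₁ h₂ => exact h₁.add h₂
  | smul a g _ h => exact h.const_smul a

end BasePoint

/-! ### Analytic continuation in the punctured disc -/

section Continuation

variable {R : Subring ℂ} {F : Subfield ℂ}

lemma exists_lt_forall_le {A : Set ℂ} (hA : A.Finite) {y : ℂ} {δ : ℝ}
    (h : ∀ a ∈ A, δ < ‖a - y‖) : ∃ r > δ, ∀ a ∈ A, r ≤ ‖a - y‖ := by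
  have h' : ∀ᶠ r in 𝓝[>] δ, ∀ a ∈ A, r ≤ ‖a - y‖ := by
    rw [Filter.eventually_all_finite hA]
    intro a ha
    exact Filter.mem_of_superset (Ioc_mem_nhdsGT (h a ha)) fun r hr => hr.2
  obtain ⟨r, h1, h2⟩ := (h'.and self_mem_nhdsWithin).exists
  exact ⟨r, h2, h1⟩

lemma Admissible.letters_mem {A : Set ℂ} (hAF : A ⊆ F) {c : ℂ} (hc : c ∈ F)
    {v : List (ℕ × ℂ)} (hv : Admissible A c v) : ∀ l ∈ v, l.2 ∈ F ∧ l.2 ≠ 0 := by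
  intro l hl
  obtain ⟨h0, h1, -⟩ := hv l hl
  refine ⟨?_, h0⟩
  have := F.sub_mem (hAF h1) hc
  rw [add_sub_cancel_left] at this
  simpa using F.inv_mem this

variable (F R) in
/-- The ring `R` contains the values of hyperlogarithms with letters in `F` at points of `F` in
the disc of convergence. -/
def ContainsHyperlogValues : Prop :=
  ∀ (v : List (ℕ × ℂ)) (u : ℂ), (∀ l ∈ v, l.2 ∈ F ∧ l.2 ≠ 0) → u ∈ F →
    (∀ l ∈ v, ‖l.2 * u‖ < 1) → hyperlog v u ∈ R

lemma ContainsHyperlogValues.hyperlog_mem (hR : ContainsHyperlogValues R F) {A : Set ℂ}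
    (hAF : A ⊆ F) {c y : ℂ} (hc : c ∈ F) (hy : y ∈ F) (hcy : InDisc A c y) {v : List (ℕ × ℂ)}
    (hv : Admissible A c v) : hyperlog v (y - c) ∈ R :=
  hR v _ (hv.letters_mem hAF hc) (F.sub_mem hy hc) fun l hl => by
    rw [norm_mul]
    exact hv.norm_lt hcy l hl

lemma isPreconnected_ball_diff {A : Set ℂ} (hA : A.Finite) :
    IsPreconnected (Metric.ball (0 : ℂ) 1 \ A) := by
  let e := OpenPartialHomeomorph.univUnitBall (E := ℂ)
  have hs : e.source = Set.univ := rfl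
  have ht : e.target = Metric.ball 0 1 := rfl
  have hinj : Function.Injective e := by
    rw [← Set.injOn_univ, ← hs]
    exact e.injOn
  have hc : (e ⁻¹' A).Countable := (hA.preimage hinj.injOn).countable
  have hconn := hc.isConnected_compl_of_one_lt_rank (by simp)
  have hcont : ContinuousOn e (e ⁻¹' A)ᶜ := e.continuousOn.mono (by simp [hs])
  convert hconn.isPreconnected.image e hcont using 1
  ext x
  constructor
  · rintro ⟨hx, hxA⟩
    rw [← ht] at hx
    refine ⟨e.symm x, ?_, e.right_inv hx⟩
    simpa [e.right_inv hx] using hxA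
  · rintro ⟨y, hy, rfl⟩
    exact ⟨ht ▸ e.map_source (hs ▸ Set.mem_univ y), hy⟩

/-- A representation of `f` by hyperlogarithms based at `c` yields one based at any point `y` of
`F` inside the disc around `c`. -/
lemma exists_mem_polySpan_eventuallyEq {A : Set ℂ} (hA : A.Finite) (hAF : A ⊆ F)
    (hR : ContainsHyperlogValues R F) {f g : ℂ → ℂ} {c : ℂ} (hc : c ∈ F) {D : Set ℂ}
    (hD : IsOpen D) (hD' : Convex ℝ D) (hDc : ∀ x ∈ D, InDisc A c x)
    (hg : g ∈ polySpan (hyperModule R A c)) (hfg : Set.EqOn f g D) {y : ℂ} (hy : y ∈ F)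
    (hyD : y ∈ D) (hyA : y ∉ A) : ∃ g ∈ polySpan (hyperModule R A y), f =ᶠ[𝓝 y] g := by
  obtain ⟨r, hr, hrA⟩ := exists_lt_forall_le hA (y := y) (δ := 0) fun a ha =>
    norm_pos_iff.2 (sub_ne_zero.2 fun h => hyA (h ▸ ha))
  have hΩ : IsOpen (D ∩ Metric.ball y r) := hD.inter Metric.isOpen_ball
  have hΩ' : IsPreconnected (D ∩ Metric.ball y r) :=
    (hD'.inter (convex_ball y r)).isPreconnected
  have hyΩ : y ∈ D ∩ Metric.ball y r := ⟨hyD, Metric.mem_ball_self hr⟩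
  have hdisc : ∀ x ∈ D ∩ Metric.ball y r, InDisc A y x := fun x hx a ha _ =>
    (mem_ball_iff_norm.1 hx.2).trans_le (hrA a ha)
  obtain ⟨G, hG, hGe⟩ := exists_mem_polySpan_eqOn (M' := hyperModule R A y)
    (Ω := D ∩ Metric.ball y r) rfl (by
      rintro _ ⟨v, hv, rfl⟩
      refine exists_eqOn_hyperlog hΩ hΩ' hyΩ (one_mem_hyperModule A y)
        (primitiveClosed_hyperModule hyA hdisc)
        (fun g hg => apply_self_mem_of_mem_hyperModule hg) ?_ (fun x hx => hDc x hx.1)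
        (fun v hv => hR.hyperlog_mem hAF hc hy (hDc y hyD) hv) hv
      intro x hx hxA
      exact ((mem_ball_iff_norm.1 hx.2).trans_le (hrA x hxA)).ne rfl) hg
  exact ⟨G, hG, Filter.eventuallyEq_of_mem (hΩ.mem_nhds hyΩ)
    fun x hx => (hfg hx.1).trans (hGe hx)⟩

lemma analyticOnNhd_of_mem_polySpan {A D : Set ℂ} {c : ℂ} (hD : IsOpen D)
    (hDc : ∀ x ∈ D, InDisc A c x) {g : ℂ → ℂ} (hg : g ∈ polySpan (hyperModule R A c)) :
    AnalyticOnNhd ℂ g D :=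
  DifferentiableOn.analyticOnNhd (fun x hx => (differentiableAt_of_mem_polySpan
    (fun _ hg => differentiableAt_of_mem_hyperModule hg (hDc x hx)) hg).differentiableWithinAt) hD

/-- A function analytic in the unit disc that is, near `0`, a combination of hyperlogarithms based
at `0` is a combination of hyperlogarithms based at `y` near every point `y` of `F` in the disc
that is not a singularity: the set of points near which this holds is open and closed. -/
theorem exists_mem_polySpan_of_mem_ball {A : Set ℂ} (hA : A.Finite) (hAF : A ⊆ F)
    (hdense : Dense (F : Set ℂ)) (hR : ContainsHyperlogValues R F) {f g : ℂ → ℂ}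
    (hf : DifferentiableOn ℂ f (Metric.ball 0 1)) (hg : g ∈ polySpan (hyperModule R A 0))
    (hfg : f =ᶠ[𝓝 0] g) {y : ℂ} (hy : y ∈ F) (hy1 : y ∈ Metric.ball (0 : ℂ) 1) (hyA : y ∉ A) :
    ∃ g ∈ polySpan (hyperModule R A y), f =ᶠ[𝓝 y] g := by
  set U : Set ℂ := Metric.ball (0 : ℂ) 1 \ A with hU
  have hUo : IsOpen U := Metric.isOpen_ball.sdiff hA.isClosed
  let P : Set ℂ := {x | ∃ ε > 0, ∀ y ∈ F, y ∈ U → ‖y - x‖ < ε →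
    ∃ g ∈ polySpan (hyperModule R A y), f =ᶠ[𝓝 y] g}
  suffices U ⊆ P by
    obtain ⟨ε, hε, h⟩ := this (⟨hy1, hyA⟩ : y ∈ U)
    exact h y hy ⟨hy1, hyA⟩ (by simpa using hε)
  refine (isPreconnected_ball_diff hA).subset_of_closure_inter_subset ?_ ?_ ?_
  · rw [Metric.isOpen_iff]
    rintro x ⟨ε, hε, h⟩
    refine ⟨ε / 2, half_pos hε, fun x' hx' => ⟨ε / 2, half_pos hε, fun y hy hyU hyx => ?_⟩⟩
    refine h y hy hyU ?_
    have := norm_sub_le_norm_sub_add_norm_sub y x' x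
    rw [mem_ball_iff_norm] at hx'
    linarith
  · -- near `0` the given representation can be moved to any other base point
    obtain ⟨r, hr, hrA⟩ := exists_lt_forall_le (hA.subset (Set.sdiff_subset (t := {0})))
      (y := 0) (δ := 0) fun a ha => norm_pos_iff.2 (sub_ne_zero.2 ha.2)
    obtain ⟨δ, hδ, hδf⟩ := Metric.eventually_nhds_iff_ball.1 hfg
    have hDc : ∀ x ∈ Metric.ball (0 : ℂ) (min r δ), InDisc A 0 x := by
      intro x hx a ha ha0
      rw [mem_ball_iff_norm] at hx
      exact (hx.trans_le (min_le_left _ _)).trans_le (hrA a ⟨ha, ha0⟩)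
    have h0 : (0 : ℂ) ∈ closure U := by
      have : Metric.ball (0 : ℂ) 1 ⊆ closure U := by
        have hd : Dense Aᶜ := hA.countable.dense_compl ℂ
        have := hd.open_subset_closure_inter (Metric.isOpen_ball (x := (0 : ℂ)) (ε := 1))
        exact this
      exact this (Metric.mem_ball_self one_pos)
    have hmin : 0 < min r δ := lt_min hr hδ
    obtain ⟨x, hxU, hx⟩ := Metric.mem_closure_iff.1 h0 _ hmin
    refine ⟨x, hxU, min r δ - ‖x‖, by simpa [dist_eq_norm] using hx, fun y hy hyU hyx => ?_⟩
    refine exists_mem_polySpan_eventuallyEq hA hAF hR F.zero_mem Metric.isOpen_ball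
      (convex_ball 0 (min r δ)) hDc hg (fun x hx => hδf x ?_) hy ?_ hyU.2
    · exact Metric.ball_subset_ball (min_le_right _ _) hx
    · rw [mem_ball_zero_iff]
      have := norm_sub_norm_le y x
      linarith
  · -- a limit point in `U` is within reach of a nearby point of `F` with a representation
    rintro x ⟨hxP, hxU⟩
    obtain ⟨ε, hε, hεU⟩ := Metric.isOpen_iff.1 hUo x hxU
    have hsub : ∀ y, ‖y - x‖ < ε / 3 → ∀ a ∈ A, 2 / 3 * ε < ‖a - y‖ := by
      intro y hy a ha
      have h1 : ε ≤ ‖a - x‖ := by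
        by_contra! h
        exact (hεU (mem_ball_iff_norm.2 h)).2 ha
      have := norm_sub_le_norm_sub_add_norm_sub a y x
      linarith
    obtain ⟨x', ⟨ε', hε', h'⟩, hx'⟩ := Metric.mem_closure_iff.1 hxP (ε / 6) (by positivity)
    obtain ⟨y, hyF, hy⟩ := Metric.mem_closure_iff.1 (hdense x') (min ε' (ε / 6)) (by positivity)
    rw [dist_comm, dist_eq_norm] at hx' hy
    have hyx : ‖y - x‖ < ε / 3 := by
      have := norm_sub_le_norm_sub_add_norm_sub y x' x
      have := hy.trans_le (min_le_right _ _)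
      linarith
    have hyU : y ∈ U := hεU (mem_ball_iff_norm.2 (by linarith))
    obtain ⟨g₁, hg₁, hfg₁⟩ := h' y hyF hyU (hy.trans_le (min_le_left _ _))
    have hDo : IsOpen (Metric.ball y (2 / 3 * ε) ∩ Metric.ball 0 1) :=
      Metric.isOpen_ball.inter Metric.isOpen_ball
    have hDconv : Convex ℝ (Metric.ball y (2 / 3 * ε) ∩ Metric.ball 0 1) :=
      (convex_ball _ _).inter (convex_ball _ _)
    have hDc : ∀ z ∈ Metric.ball y (2 / 3 * ε) ∩ Metric.ball 0 1, InDisc A y z :=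
      fun z hz a ha _ => (mem_ball_iff_norm.1 hz.1).trans (hsub y hyx a ha)
    have heq : Set.EqOn f g₁ (Metric.ball y (2 / 3 * ε) ∩ Metric.ball 0 1) :=
      ((hf.mono Set.inter_subset_right).analyticOnNhd hDo).eqOn_of_preconnected_of_eventuallyEq
        (analyticOnNhd_of_mem_polySpan hDo hDc hg₁) hDconv.isPreconnected
        ⟨Metric.mem_ball_self (by positivity), hyU.1⟩ hfg₁
    refine ⟨ε / 3, by positivity, fun y' hy'F hy'U hy' => ?_⟩
    refine exists_mem_polySpan_eventuallyEq hA hAF hR hyF hDo hDconv hDc hg₁ heq hy'F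
      ⟨mem_ball_iff_norm.2 ?_, hy'U.1⟩ hy'U.2
    have := norm_sub_le_norm_sub_add_norm_sub y' x y
    rw [norm_sub_rev x y] at this
    linarith

/-! ### Behaviour at the point `1` -/

/-- The logarithm with branch point `1`, normalised to vanish at `y`. -/
noncomputable def logAtOne (y : ℝ) (x : ℂ) : ℂ := Complex.log ((1 - x) / ((1 - y : ℝ) : ℂ))

lemma logAtOne_self {y : ℝ} (hy : y < 1) : logAtOne y y = 0 := by
  have : ((1 - y : ℝ) : ℂ) ≠ 0 := by exact_mod_cast (sub_pos.2 hy).ne'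
  rw [logAtOne, show (1 - (y : ℂ)) = ((1 - y : ℝ) : ℂ) by push_cast; ring, div_self this,
    Complex.log_one]

lemma hasDerivAt_logAtOne {y : ℝ} (hy : y < 1) {x : ℂ} (hx : x ∈ Metric.ball (y : ℂ) (1 - y)) :
    HasDerivAt (logAtOne y) (1 / (x - 1)) x := by
  have hre : x.re < 1 := by
    rw [mem_ball_iff_norm] at hx
    have := (Complex.abs_re_le_norm (x - y)).trans_lt hx
    rw [Complex.sub_re, Complex.ofReal_re] at this
    linarith [(abs_lt.1 this).2]
  have hy0 : ((1 - y : ℝ) : ℂ) ≠ 0 := by exact_mod_cast (sub_pos.2 hy).ne'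
  have hx1 : x - 1 ≠ 0 := by
    intro h
    rw [sub_eq_zero.1 h] at hre
    simp at hre
  have hx1' : 1 - x ≠ 0 := by
    intro h
    exact hx1 (by linear_combination -h)
  have hslit : (1 - x) / ((1 - y : ℝ) : ℂ) ∈ Complex.slitPlane := by
    refine Or.inl ?_
    rw [Complex.div_ofReal_re]
    exact div_pos (by simpa using hre) (sub_pos.2 hy)
  have h := (((hasDerivAt_id x).const_sub 1).div_const ((1 - y : ℝ) : ℂ)).clog hslit
  convert! h using 1
  simp only [id]
  field_simp
  ring

variable (R) in
/-- The combinations of products of powers of the logarithm and of hyperlogarithms based at the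
singular point `1`. -/
def logModule (A : Set ℂ) (y : ℝ) : Submodule R (ℂ → ℂ) :=
  Submodule.span R {f | ∃ (j : ℕ) (v : List (ℕ × ℂ)), Admissible A 1 v ∧
    f = fun x => logAtOne y x ^ j * hyperlog v (x - 1)}

lemma mem_logModule {A : Set ℂ} {y : ℝ} (j : ℕ) {v : List (ℕ × ℂ)} (hv : Admissible A 1 v) :
    (fun x => logAtOne y x ^ j * hyperlog v (x - 1)) ∈ logModule R A y :=
  Submodule.subset_span ⟨j, v, hv, rfl⟩

lemma hasDerivAt_logAtOne_pow {y : ℝ} (hy : y < 1) {x : ℂ}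
    (hx : x ∈ Metric.ball (y : ℂ) (1 - y)) (j : ℕ) :
    HasDerivAt (fun x => logAtOne y x ^ (j + 1)) ((j + 1) * logAtOne y x ^ j / (x - 1)) x := by
  have := (hasDerivAt_logAtOne hy hx).fun_pow (j + 1)
  convert! this using 1
  push_cast
  ring_nf

/-- Integration by parts: primitives of `log ^ j * L dx / (x - 1)` for a hyperlogarithm `L`
without constant term. -/
lemma exists_primitive_log_mul {A : Set ℂ} (h1A : (1 : ℂ) ∈ A) {y : ℝ} (hy : y < 1)
    (hdisc : ∀ x ∈ Metric.ball (y : ℂ) (1 - y), InDisc A 1 x)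
    (hne : ∀ x ∈ Metric.ball (y : ℂ) (1 - y), x ≠ 1) (j r : ℕ) {τ : ℂ} {v : List (ℕ × ℂ)}
    (hv : Admissible A 1 ((r, τ) :: v)) :
    ∃ G ∈ logModule R A y, ∀ x ∈ Metric.ball (y : ℂ) (1 - y),
      HasDerivAt G (logAtOne y x ^ j * hyperlog ((r, τ) :: v) (x - 1) / (x - 1)) x := by
  have hv' : Admissible A 1 ((r + 1, τ) :: v) := by
    intro l hl
    rcases List.mem_cons.1 hl with rfl | hl
    · exact ⟨(hv _ List.mem_cons_self).1, (hv _ List.mem_cons_self).2.1, Or.inr h1A⟩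
    · exact hv l (List.mem_cons_of_mem _ hl)
  induction j generalizing r with
  | zero =>
    refine ⟨_, mem_logModule 0 hv', fun x hx => ?_⟩
    simpa using hv.hasDerivAt_succ (hdisc x hx) (hne x hx)
  | succ j ih =>
    have hv'' : Admissible A 1 ((r + 1 + 1, τ) :: v) := by
      intro l hl
      rcases List.mem_cons.1 hl with rfl | hl
      · exact ⟨(hv _ List.mem_cons_self).1, (hv _ List.mem_cons_self).2.1, Or.inr h1A⟩
      · exact hv l (List.mem_cons_of_mem _ hl)
    obtain ⟨G, hG, hGd⟩ := ih (r + 1) hv' hv''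
    refine ⟨_, sub_mem (mem_logModule (j + 1) hv') (nsmul_mem hG (j + 1)), fun x hx => ?_⟩
    have h := ((hasDerivAt_logAtOne_pow hy hx j).mul
      (hv.hasDerivAt_succ (hdisc x hx) (hne x hx))).sub ((hGd x hx).const_mul ((j : ℂ) + 1))
    convert! h using 1
    · ext x
      simp [nsmul_eq_mul]
    · ring

lemma primitiveClosed_logModule {A : Set ℂ} (h1A : (1 : ℂ) ∈ A) (hF : ∀ x ∈ F, x ∈ R) {y : ℝ}
    (hy : y < 1) (hdisc : ∀ x ∈ Metric.ball (y : ℂ) (1 - y), InDisc A 1 x)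
    (hne : ∀ x ∈ Metric.ball (y : ℂ) (1 - y), x ≠ 1) :
    PrimitiveClosed A (Metric.ball (y : ℂ) (1 - y)) (logModule R A y) := by
  refine primitiveClosed_span ?_
  rintro _ ⟨j, v, hv, rfl⟩ a ha
  by_cases ha1 : a = 1
  · subst ha1
    cases v with
    | cons l v => exact exists_primitive_log_mul h1A hy hdisc hne j l.1 hv
    | nil =>
      have hj : ((j : ℂ) + 1)⁻¹ ∈ R :=
        hF _ (F.inv_mem (F.add_mem (natCast_mem F j) F.one_mem))
      refine ⟨_, Submodule.smul_mem _ (⟨_, hj⟩ : R) (mem_logModule (j + 1) hv),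
        fun x hx => ?_⟩
      have hj0 : (j : ℂ) + 1 ≠ 0 := by exact_mod_cast Nat.succ_ne_zero j
      have h := (hasDerivAt_logAtOne_pow hy hx j).const_mul ((j : ℂ) + 1)⁻¹
      convert! h using 1
      · ext x
        simp [Subring.smul_def, hyperlog_nil]
      · simp only [hyperlog_nil]
        field_simp
  · have hd : ∀ x ∈ Metric.ball (y : ℂ) (1 - y), _ := fun x hx =>
      hv.hasDerivAt_cons_zero ha ha1 (hdisc x hx)
    have hv' := hv.cons_zero ha ha1
    cases j with
    | zero =>
      refine ⟨_, neg_mem (mem_logModule 0 hv'), fun x hx => ?_⟩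
      have h := hd x hx
      convert! h using 1
      · ext x
        simp
      · simp
    | succ j =>
      obtain ⟨G, hG, hGd⟩ := exists_primitive_log_mul (R := R) h1A hy hdisc hne j 0 hv'
      refine ⟨_, add_mem (neg_mem (mem_logModule (j + 1) hv')) (nsmul_mem hG (j + 1)),
        fun x hx => ?_⟩
      have h := ((hasDerivAt_logAtOne_pow hy hx j).mul (hd x hx)).add
        ((hGd x hx).const_mul ((j : ℂ) + 1))
      convert! h using 1
      · ext x
        simp [nsmul_eq_mul]
      · simp only [Pi.neg_apply]
        ring

lemma one_mem_logModule (A : Set ℂ) (y : ℝ) : (fun _ => 1) ∈ logModule R A y := by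
  have := mem_logModule (R := R) (y := y) 0 (admissible_nil A 1)
  simpa only [hyperlog_nil, pow_zero, mul_one] using this

lemma apply_mem_of_mem_logModule {A : Set ℂ} {y : ℝ} (hy : y < 1)
    (hval : ∀ v, Admissible A 1 v → hyperlog v (y - 1) ∈ R) {g : ℂ → ℂ}
    (hg : g ∈ logModule R A y) : g y ∈ R := by
  induction hg using Submodule.span_induction with
  | mem g hg =>
    obtain ⟨j, v, hv, rfl⟩ := hg
    refine R.mul_mem (R.pow_mem ?_ j) (hval v hv)
    rw [logAtOne_self hy]
    exact R.zero_mem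
  | zero => exact R.zero_mem
  | add g₁ g₂ _ _ h₁ h₂ => exact R.add_mem h₁ h₂
  | smul a g _ h => exact R.mul_mem a.2 h

end Continuation

section Limit

variable {R : Subring ℂ} {F : Subfield ℂ}

lemma logAtOne_ofReal {y : ℝ} (hy : y < 1) {x : ℝ} (hx : x < 1) :
    logAtOne y x = (Real.log ((1 - x) / (1 - y)) : ℝ) := by
  rw [logAtOne, Complex.ofReal_log (div_nonneg (sub_pos.2 hx).le (sub_pos.2 hy).le)]
  push_cast
  rfl

lemma tendsto_one_sub_div {y : ℝ} (hy : y < 1) :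
    Tendsto (fun x : ℝ => (1 - x) / (1 - y)) (𝓝[<] 1) (𝓝[>] 0) := by
  refine tendsto_nhdsWithin_iff.2 ⟨?_, ?_⟩
  · have : Tendsto (fun x : ℝ => (1 - x) / (1 - y)) (𝓝 1) (𝓝 ((1 - 1) / (1 - y))) :=
      ((continuous_const.sub continuous_id).div_const _).tendsto 1
    rw [sub_self, zero_div] at this
    exact this.mono_left nhdsWithin_le_nhds
  · filter_upwards [self_mem_nhdsWithin] with x hx
    exact div_pos (sub_pos.2 hx) (sub_pos.2 hy)

lemma tendsto_norm_logAtOne {y : ℝ} (hy : y < 1) :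
    Tendsto (fun x : ℝ => ‖logAtOne y x‖) (𝓝[<] 1) atTop := by
  have h := tendsto_abs_atBot_atTop.comp
    (Real.tendsto_log_nhdsGT_zero.comp (tendsto_one_sub_div hy))
  refine h.congr' ?_
  filter_upwards [self_mem_nhdsWithin] with x hx
  rw [logAtOne_ofReal hy hx, Complex.norm_real, Real.norm_eq_abs]
  rfl

lemma tendsto_log_pow_mul_self (j : ℕ) :
    Tendsto (fun t : ℝ => |Real.log t| ^ j * t) (𝓝[>] 0) (𝓝 0) := by
  have h := (Real.isLittleO_pow_log_id_atTop (n := j)).tendsto_div_nhds_zero.comp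
    tendsto_inv_nhdsGT_zero
  have h' := h.norm
  rw [norm_zero] at h'
  refine h'.congr' ?_
  filter_upwards [self_mem_nhdsWithin] with t ht
  have ht0 : (0 : ℝ) < t := ht
  rw [Function.comp, norm_div, norm_pow, Real.log_inv, norm_neg, id, norm_inv, div_inv_eq_mul,
    Real.norm_eq_abs, Real.norm_of_nonneg ht0.le]

/-- Powers of the logarithm are killed by functions vanishing at `1`. -/
lemma tendsto_logAtOne_pow_mul {y : ℝ} (hy : y < 1) (j : ℕ) {h : ℂ → ℂ}
    (hd : DifferentiableAt ℂ h 1) (h1 : h 1 = 0) :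
    Tendsto (fun x : ℝ => logAtOne y x ^ j * h x) (𝓝[<] 1) (𝓝 0) := by
  have hO : (fun x : ℝ => h x) =O[𝓝[<] 1] fun x : ℝ => ((1 - x) / (1 - y) : ℝ) := by
    have hO1 := hd.isBigO_sub
    simp only [h1, sub_zero] at hO1
    have hcast : Tendsto (fun x : ℝ => (x : ℂ)) (𝓝[<] 1) (𝓝 1) := by
      have : Tendsto (fun x : ℝ => (x : ℂ)) (𝓝 1) (𝓝 ((1 : ℝ) : ℂ)) :=
        Complex.continuous_ofReal.tendsto 1
      rw [Complex.ofReal_one] at this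
      exact this.mono_left nhdsWithin_le_nhds
    refine (hO1.comp_tendsto hcast).trans ?_
    refine Asymptotics.IsBigO.of_bound (1 - y) (Eventually.of_forall fun x => ?_)
    have hy' := sub_pos.2 hy
    rw [Function.comp, norm_div, Real.norm_of_nonneg hy'.le, mul_div_cancel₀ _ hy'.ne',
      ← Complex.ofReal_one, ← Complex.ofReal_sub, Complex.norm_real, norm_sub_rev]
  have hlog : (fun x : ℝ => logAtOne y x ^ j) =O[𝓝[<] 1]
      fun x : ℝ => |Real.log ((1 - x) / (1 - y))| ^ j := by
    refine Asymptotics.IsBigO.of_bound 1 ?_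
    filter_upwards [self_mem_nhdsWithin] with x hx
    rw [logAtOne_ofReal hy hx, norm_pow, Complex.norm_real, norm_pow, Real.norm_eq_abs,
      Real.norm_eq_abs, abs_abs, one_mul]
  exact (hlog.mul hO).trans_tendsto
    ((tendsto_log_pow_mul_self j).comp (tendsto_one_sub_div hy))

variable (R) in
/-- As `x` increases to `1`, the function `f` is asymptotic to a polynomial in the logarithm
with constant coefficient in `R`. -/
def HasLogExpansion (y : ℝ) (f : ℂ → ℂ) : Prop :=
  ∃ P : Polynomial ℂ, P.coeff 0 ∈ R ∧
    Tendsto (fun x : ℝ => f x - P.eval (logAtOne y x)) (𝓝[<] 1) (𝓝 0)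

lemma HasLogExpansion.zero (y : ℝ) : HasLogExpansion R y fun _ => 0 := ⟨0, by simp, by simp⟩

lemma HasLogExpansion.add {y : ℝ} {f g : ℂ → ℂ} (hf : HasLogExpansion R y f)
    (hg : HasLogExpansion R y g) : HasLogExpansion R y fun x => f x + g x := by
  obtain ⟨P, hP, hPf⟩ := hf
  obtain ⟨Q, hQ, hQg⟩ := hg
  refine ⟨P + Q, by simpa using R.add_mem hP hQ, ?_⟩
  have := hPf.add hQg
  rw [add_zero] at this
  refine this.congr fun x => ?_
  rw [Polynomial.eval_add]
  ring

lemma HasLogExpansion.const_mul {y : ℝ} {f : ℂ → ℂ} (hf : HasLogExpansion R y f) (c : R) :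
    HasLogExpansion R y fun x => (c : ℂ) * f x := by
  obtain ⟨P, hP, hPf⟩ := hf
  refine ⟨Polynomial.C (c : ℂ) * P, by simpa using R.mul_mem c.2 hP, ?_⟩
  have := hPf.const_mul (c : ℂ)
  rw [mul_zero] at this
  refine this.congr fun x => ?_
  rw [Polynomial.eval_mul, Polynomial.eval_C]
  ring

lemma hasLogExpansion_of_mem_polySpan {A : Set ℂ} {y : ℝ} (hy : y < 1) (h1A : InDisc A 1 1)
    {f : ℂ → ℂ} (hf : f ∈ polySpan (logModule R A y)) : HasLogExpansion R y f := by
  induction hf using Submodule.span_induction with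
  | mem f hf =>
    obtain ⟨m, g, hg, rfl⟩ := hf
    induction hg using Submodule.span_induction with
    | mem g hg =>
      obtain ⟨j, v, hv, rfl⟩ := hg
      cases v with
      | nil =>
        refine ⟨Polynomial.X ^ j, ?_, ?_⟩
        · rw [Polynomial.coeff_X_pow]
          split_ifs
          · exact R.one_mem
          · exact R.zero_mem
        · refine (tendsto_logAtOne_pow_mul hy j (h := fun x => x ^ m - 1)
            ((differentiableAt_pow m).sub_const 1) (by simp)).congr fun x => ?_
          simp only [hyperlog_nil, Polynomial.eval_pow, Polynomial.eval_X]
          ring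
      | cons l v =>
        refine ⟨0, by simp, ?_⟩
        refine (tendsto_logAtOne_pow_mul hy j (h := fun x => x ^ m * hyperlog (l :: v) (x - 1))
          ((differentiableAt_pow m).mul (hv.differentiableAt h1A)) ?_).congr fun x => ?_
        · simp [hyperlog_zero]
        · simp only [Polynomial.eval_zero]
          ring
    | zero =>
      have e : (fun x : ℂ => x ^ m * (0 : ℂ → ℂ) x) = fun _ => 0 := funext fun x => mul_zero _
      rw [e]
      exact .zero y
    | add g₁ g₂ _ _ h₁ h₂ =>
      have e : (fun x : ℂ => x ^ m * (g₁ + g₂) x) = fun x => x ^ m * g₁ x + x ^ m * g₂ x :=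
        funext fun x => mul_add _ _ _
      rw [e]
      exact h₁.add h₂
    | smul c g _ h =>
      have e : (fun x : ℂ => x ^ m * (c • g) x) = fun x => (c : ℂ) * (x ^ m * g x) :=
        funext fun x => mul_left_comm _ _ _
      rw [e]
      exact h.const_mul c
  | zero => exact .zero y
  | add g₁ g₂ _ _ h₁ h₂ => exact h₁.add h₂
  | smul c g _ h => exact h.const_mul c

/-- The limit at `1` of such a combination lies in `R`: a polynomial in the logarithm that stays
bounded as the logarithm tends to infinity is constant. -/
lemma mem_of_tendsto_of_mem_polySpan {A : Set ℂ} {y : ℝ} (hy : y < 1) (h1A : InDisc A 1 1)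
    {f : ℂ → ℂ} (hf : f ∈ polySpan (logModule R A y)) {S : ℂ}
    (hS : Tendsto (fun x : ℝ => f x) (𝓝[<] 1) (𝓝 S)) : S ∈ R := by
  obtain ⟨P, hP0, hP⟩ := hasLogExpansion_of_mem_polySpan hy h1A hf
  have hlim : Tendsto (fun x : ℝ => P.eval (logAtOne y x)) (𝓝[<] 1) (𝓝 S) := by
    have := hS.sub hP
    rw [sub_zero] at this
    exact this.congr fun x => by ring
  have hdeg : P.degree ≤ 0 := by
    by_contra! h
    exact not_tendsto_nhds_of_tendsto_atTop
      (P.tendsto_norm_atTop h (tendsto_norm_logAtOne hy)) _ hlim.norm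
  rw [Polynomial.eq_C_of_degree_le_zero hdeg] at hlim
  simp only [Polynomial.eval_C] at hlim
  rwa [tendsto_nhds_unique hlim tendsto_const_nhds]

lemma differentiableOn_tsum_of_tendsto {G : ℕ → ℂ} {S : ℂ}
    (hG : Tendsto (fun N => ∑ n ∈ Finset.range N, G n) atTop (𝓝 S)) :
    DifferentiableOn ℂ (fun x => ∑' n, G n * x ^ n) (Metric.ball 0 1) := by
  have h0 : Tendsto G atTop (𝓝 0) := by
    have := (hG.comp (tendsto_add_atTop_nat 1)).sub hG
    rw [sub_self] at this
    refine this.congr fun n => ?_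
    simp [Finset.sum_range_succ]
  obtain ⟨C, hC⟩ := h0.norm.bddAbove_range
  intro x hx
  rw [mem_ball_zero_iff] at hx
  obtain ⟨ρ, hxρ, hρ⟩ := exists_between hx
  have hρ0 : 0 ≤ ρ := (norm_nonneg x).trans hxρ.le
  refine ((Complex.differentiableOn_tsum_of_summable_norm (u := fun n => C * ρ ^ n)
    (U := Metric.ball 0 ρ) ((summable_geometric_of_lt_one hρ0 hρ).mul_left C)
    (fun n => by fun_prop) Metric.isOpen_ball fun n w hw => ?_).differentiableAt
      (Metric.isOpen_ball.mem_nhds (mem_ball_zero_iff.2 hxρ))).differentiableWithinAt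
  rw [norm_mul, norm_pow]
  rw [mem_ball_zero_iff] at hw
  have hCn : ‖G n‖ ≤ C := hC ⟨n, rfl⟩
  gcongr
  exact (norm_nonneg _).trans hCn

/-- If a series has a generating function that is a combination of hyperlogarithms near `0`, its
sum is a combination of values of hyperlogarithms inside their discs of convergence. By Abel's
theorem the sum is a boundary value at `1`, which is computed by continuing the hyperlogarithms
from `0` to a point near `1` and expanding them in powers of the logarithm there. -/
theorem mem_of_tendsto_sum {A : Set ℂ} (hA : A.Finite) (hAF : A ⊆ F) (h1A : (1 : ℂ) ∈ A)
    (hdense : Dense (F : Set ℂ)) (hF : ∀ x ∈ F, x ∈ R) (hR : ContainsHyperlogValues R F)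
    {G : ℕ → ℂ} {g : ℂ → ℂ} (hg : g ∈ polySpan (hyperModule R A 0))
    (hGg : ∀ᶠ x in 𝓝 0, HasSum (fun n => G n * x ^ n) (g x)) {S : ℂ}
    (hS : Tendsto (fun N => ∑ n ∈ Finset.range N, G n) atTop (𝓝 S)) : S ∈ R := by
  have hf := differentiableOn_tsum_of_tendsto hS
  have habel : Tendsto (fun x : ℝ => ∑' n, G n * (x : ℂ) ^ n) (𝓝[<] 1) (𝓝 S) :=
    Complex.tendsto_tsum_powerSeries_nhdsWithin_lt hS
  set f : ℂ → ℂ := fun x => ∑' n, G n * x ^ n with hfdef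
  have hfg : f =ᶠ[𝓝 0] g := hGg.mono fun x hx => hx.tsum_eq
  obtain ⟨r, hr, hrA⟩ := exists_lt_forall_le (hA.subset (Set.sdiff_subset (t := {1})))
    (y := 1) (δ := 0) fun a ha => norm_pos_iff.2 (sub_ne_zero.2 ha.2)
  -- the base point is closer to `1` than half the distance from `1` to the other singularities
  obtain ⟨q, hq, hq1⟩ := exists_rat_btwn (show max 0 (1 - r / 2) < 1 from
    max_lt one_pos (by linarith))
  rw [max_lt_iff] at hq
  obtain ⟨hq0, hqr⟩ := hq
  set y : ℝ := (q : ℝ) with hy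
  have hyF : (y : ℂ) ∈ F := by
    rw [hy, Complex.ofReal_ratCast]
    exact SubfieldClass.ratCast_mem F q
  have hball1 : ∀ x ∈ Metric.ball (y : ℂ) (1 - y), x ∈ Metric.ball (0 : ℂ) 1 := by
    intro x hx
    rw [mem_ball_iff_norm] at hx
    rw [mem_ball_zero_iff]
    have h1 := norm_sub_norm_le x y
    rw [Complex.norm_of_nonneg hq0.le] at h1
    linarith
  have hne : ∀ x ∈ Metric.ball (y : ℂ) (1 - y), x ≠ 1 := by
    rintro x hx rfl
    simpa using hball1 1 hx
  have h1y : ‖(1 : ℂ) - y‖ = 1 - y := by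
    rw [← Complex.ofReal_one, ← Complex.ofReal_sub, Complex.norm_of_nonneg (by linarith)]
  have hdisc1 : ∀ x ∈ Metric.ball (y : ℂ) (1 - y), InDisc A 1 x := by
    intro x hx a ha ha1
    have h := hrA a ⟨ha, ha1⟩
    rw [mem_ball_iff_norm] at hx
    have := norm_sub_le_norm_sub_add_norm_sub x y 1
    rw [norm_sub_rev (y : ℂ) 1, h1y] at this
    linarith
  have hdisc : ∀ x ∈ Metric.ball (y : ℂ) (1 - y), InDisc A y x := by
    intro x hx a ha _
    rw [mem_ball_iff_norm] at hx
    refine hx.trans_le ?_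
    by_cases ha1 : a = 1
    · rw [ha1, h1y]
    · have h := hrA a ⟨ha, ha1⟩
      have := norm_sub_le_norm_sub_add_norm_sub a y 1
      rw [norm_sub_rev (y : ℂ) 1, h1y] at this
      linarith
  have hys : (y : ℂ) ∈ Metric.ball (y : ℂ) (1 - y) := Metric.mem_ball_self (by linarith)
  have hnotA : ∀ x ∈ Metric.ball (y : ℂ) (1 - y), x ∉ A := by
    intro x hx hxA
    exact lt_irrefl _ (hdisc1 x hx x hxA (hne x hx))
  obtain ⟨g₁, hg₁, hfg₁⟩ := exists_mem_polySpan_of_mem_ball hA hAF hdense hR hf hg hfg hyF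
    (hball1 _ hys) (hnotA _ hys)
  have heq₁ : Set.EqOn f g₁ (Metric.ball (y : ℂ) (1 - y)) :=
    ((hf.mono hball1).analyticOnNhd Metric.isOpen_ball).eqOn_of_preconnected_of_eventuallyEq
      (analyticOnNhd_of_mem_polySpan Metric.isOpen_ball hdisc hg₁)
      (convex_ball _ _).isPreconnected hys hfg₁
  have hval : ∀ v, Admissible A 1 v → hyperlog v (y - 1) ∈ R := fun v hv =>
    hR.hyperlog_mem hAF F.one_mem hyF (hdisc1 _ hys) hv
  obtain ⟨g₂, hg₂, heq₂⟩ := exists_mem_polySpan_eqOn (M' := logModule R A y)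
    (Ω := Metric.ball (y : ℂ) (1 - y)) rfl (by
      rintro _ ⟨v, hv, rfl⟩
      refine exists_eqOn_hyperlog Metric.isOpen_ball (convex_ball _ _).isPreconnected hys
        (one_mem_logModule A y) (primitiveClosed_logModule h1A hF hq1 hdisc1 hne)
        (fun g hg => apply_mem_of_mem_logModule hq1 hval hg) hnotA hdisc
        (fun v _ => ?_) hv
      rw [sub_self]
      exact hyperlog_zero_mem R v) hg₁
  refine mem_of_tendsto_of_mem_polySpan hq1 (fun a _ ha => ?_) hg₂ (habel.congr' ?_)
  · simpa using sub_ne_zero.2 ha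
  · filter_upwards [Ioo_mem_nhdsLT hq1] with x hx
    have hxb : (x : ℂ) ∈ Metric.ball (y : ℂ) (1 - y) := by
      rw [mem_ball_iff_norm, ← Complex.ofReal_sub,
        Complex.norm_of_nonneg (sub_pos.2 hx.1).le]
      linarith [hx.2]
    exact (heq₁ hxb).trans (heq₂ hxb)

end Limit

/-! ### Spans of sequences -/

section Sequences

variable {F : Subfield ℂ}

variable (F) in
/-- Division of the `n`-th term by `n`, with value `0` at `n = 0`. On generating functions this is
integration against `dx / x`. -/
noncomputable def divIndex : (ℕ → ℂ) →ₗ[F] (ℕ → ℂ) where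
  toFun g n := g n / n
  map_add' f g := by ext n; exact add_div _ _ _
  map_smul' c f := by ext n; exact mul_div_assoc _ _ _

variable (F) in
/-- The sequence delayed by `m` steps. -/
def shiftSeq (m : ℕ) : (ℕ → ℂ) →ₗ[F] (ℕ → ℂ) where
  toFun g n := if m ≤ n then g (n - m) else 0
  map_add' f g := by
    ext n
    by_cases h : m ≤ n <;> simp [h]
  map_smul' c f := by
    ext n
    by_cases h : m ≤ n <;> simp [h]

lemma divIndex_apply (g : ℕ → ℂ) (n : ℕ) : divIndex F g n = g n / n := rfl

lemma shiftSeq_apply (m : ℕ) (g : ℕ → ℂ) (n : ℕ) :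
    shiftSeq F m g n = if m ≤ n then g (n - m) else 0 := rfl

variable (F) in
/-- The span of all delayed hyperlogarithm coefficient sequences with nonzero letters in `F`; its
generating functions are hyperlogarithms with polynomial coefficients. -/
noncomputable def hyperSeqSpan : Submodule F (ℕ → ℂ) :=
  Submodule.span F {f | ∃ (m : ℕ) (v : List (ℕ × ℂ)), (∀ l ∈ v, l.2 ∈ F ∧ l.2 ≠ 0) ∧
    f = shiftSeq F m (hyperCoeff v)}

lemma shiftSeq_mem_hyperSeqSpan (m : ℕ) {v : List (ℕ × ℂ)} (hv : ∀ l ∈ v, l.2 ∈ F ∧ l.2 ≠ 0) :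
    shiftSeq F m (hyperCoeff v) ∈ hyperSeqSpan F := Submodule.subset_span ⟨m, v, hv, rfl⟩

/-- Integrating `x ^ m` times the `x d/dx`-derivative of the series of `(0, τ) :: v` reduces to
the same problem for `v`, since `x ^ m / (1 - τ x)` is a multiple of `1 / (1 - τ x)` up to
polynomials. -/
lemma divIndex_shiftSeq_mem_aux {v : List (ℕ × ℂ)} {τ : ℂ}
    (hv : ∀ l ∈ (0, τ) :: v, l.2 ∈ F ∧ l.2 ≠ 0)
    (h : ∀ m, divIndex F (shiftSeq F m (hyperCoeff v)) ∈ hyperSeqSpan F) (m : ℕ) :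
    divIndex F (shiftSeq F m fun n => n * hyperCoeff ((0, τ) :: v) n) ∈ hyperSeqSpan F := by
  obtain ⟨hτ, hτ0⟩ := hv _ List.mem_cons_self
  induction m with
  | zero =>
    convert shiftSeq_mem_hyperSeqSpan 0 hv using 1
    ext n
    rcases Nat.eq_zero_or_pos n with rfl | hn
    · simp [divIndex_apply, shiftSeq_apply]
    · have : (n : ℂ) ≠ 0 := by exact_mod_cast hn.ne'
      simp only [divIndex_apply, shiftSeq_apply, zero_le, if_true, Nat.sub_zero]
      field_simp
  | succ m ih =>
    have e : (shiftSeq F (m + 1) fun n => n * hyperCoeff ((0, τ) :: v) n) =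
        (⟨τ⁻¹, F.inv_mem hτ⟩ : F) • (shiftSeq F m fun n => n * hyperCoeff ((0, τ) :: v) n) -
          shiftSeq F (m + 1) (hyperCoeff v) := by
      ext n
      simp only [Pi.sub_apply, Pi.smul_apply, Subfield.smul_def, smul_eq_mul, shiftSeq_apply]
      rcases lt_trichotomy n m with hn | rfl | hn
      · rw [if_neg (by omega), if_neg (by omega), if_neg (by omega)]
        simp
      · simp
      · obtain ⟨i, rfl⟩ := Nat.exists_eq_add_of_le hn
        rw [if_pos (by omega), if_pos (by omega), if_pos (by omega),
          show m.succ + i - (m + 1) = i by omega, show m.succ + i - m = i + 1 by omega,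
          succ_mul_hyperCoeff_zero, inv_mul_cancel_left₀ hτ0]
        ring
    rw [e, map_sub, map_smul]
    exact sub_mem (Submodule.smul_mem _ _ ih) (h (m + 1))

lemma divIndex_shiftSeq_mem {v : List (ℕ × ℂ)} (hv : ∀ l ∈ v, l.2 ∈ F ∧ l.2 ≠ 0) (m : ℕ) :
    divIndex F (shiftSeq F m (hyperCoeff v)) ∈ hyperSeqSpan F := by
  induction v generalizing m with
  | nil =>
    convert Submodule.smul_mem _ ((m : F)⁻¹) (shiftSeq_mem_hyperSeqSpan m hv) using 1
    ext n
    simp only [divIndex_apply, Pi.smul_apply, Subfield.smul_def, smul_eq_mul, shiftSeq_apply]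
    rcases lt_trichotomy n m with hn | rfl | hn
    · rw [if_neg (by omega)]
      simp
    · simp
    · rw [if_pos hn.le]
      obtain ⟨i, rfl⟩ := Nat.exists_eq_add_of_le hn
      rw [show m.succ + i - m = i + 1 by omega]
      simp
  | cons l v ih =>
    obtain ⟨r, τ⟩ := l
    have hv' : ∀ r' : ℕ, ∀ l ∈ (r', τ) :: v, l.2 ∈ F ∧ l.2 ≠ 0 := by simpa using hv
    have ih' := ih fun l hl => hv l (List.mem_cons_of_mem _ hl)
    rcases Nat.eq_zero_or_pos m with rfl | hm
    · convert shiftSeq_mem_hyperSeqSpan 0 (hv' (r + 1)) using 1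
      ext n
      simp only [divIndex_apply, shiftSeq_apply, zero_le, if_true, Nat.sub_zero]
      rw [← natCast_mul_hyperCoeff_succ]
      rcases Nat.eq_zero_or_pos n with rfl | hn
      · simp
      · have : (n : ℂ) ≠ 0 := by exact_mod_cast hn.ne'
        field_simp
    · -- integration by parts, lowering the exponent of the first letter
      have step : ∀ r' : ℕ, divIndex F (shiftSeq F m fun n => n * hyperCoeff ((r', τ) :: v) n) ∈
          hyperSeqSpan F → divIndex F (shiftSeq F m (hyperCoeff ((r', τ) :: v))) ∈
          hyperSeqSpan F := by
        intro r' h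
        have e : divIndex F (shiftSeq F m (hyperCoeff ((r', τ) :: v))) = (m : F)⁻¹ •
            (shiftSeq F m (hyperCoeff ((r', τ) :: v)) -
              divIndex F (shiftSeq F m fun n => n * hyperCoeff ((r', τ) :: v) n)) := by
          ext n
          simp only [divIndex_apply, Pi.smul_apply, Pi.sub_apply, Subfield.smul_def, smul_eq_mul,
            shiftSeq_apply]
          by_cases hn : m ≤ n
          · rw [if_pos hn, if_pos hn]
            have h1 : (n : ℂ) ≠ 0 := by exact_mod_cast (hm.trans_le hn).ne'
            have h2 : (m : ℂ) ≠ 0 := by exact_mod_cast hm.ne'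
            push_cast [Nat.cast_sub hn]
            field_simp
            ring
          · rw [if_neg hn, if_neg hn]
            simp
        rw [e]
        exact Submodule.smul_mem _ _ (sub_mem (shiftSeq_mem_hyperSeqSpan m (hv' r')) h)
      clear hv
      induction r with
      | zero => exact step 0 (divIndex_shiftSeq_mem_aux (hv' 0) ih' m)
      | succ r ihr =>
        refine step (r + 1) ?_
        simp only [natCast_mul_hyperCoeff_succ]
        exact ihr

lemma divIndex_mem {g : ℕ → ℂ} (hg : g ∈ hyperSeqSpan F) : divIndex F g ∈ hyperSeqSpan F := by
  have : hyperSeqSpan F ≤ (hyperSeqSpan F).comap (divIndex F) := by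
    refine Submodule.span_le.2 ?_
    rintro _ ⟨m, v, hv, rfl⟩
    exact divIndex_shiftSeq_mem hv m
  exact this hg

lemma iterate_divIndex_mem {g : ℕ → ℂ} (hg : divIndex F g ∈ hyperSeqSpan F) (q : ℕ) :
    (divIndex F)^[q + 1] g ∈ hyperSeqSpan F := by
  induction q with
  | zero => exact hg
  | succ q ih =>
    rw [Function.iterate_succ_apply']
    exact divIndex_mem ih

lemma iterate_divIndex_apply (g : ℕ → ℂ) (q n : ℕ) :
    (divIndex F)^[q] g n = g n / (n : ℂ) ^ q := by
  induction q with
  | zero => simp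
  | succ q ih => rw [Function.iterate_succ_apply', divIndex_apply, ih, div_div, pow_succ]

variable (F) in
/-- The span of the multiple harmonic numbers, as functions of `N`, of words with nonzero colours
in `F`. -/
noncomputable def harmonicSpan : Submodule F (ℕ → ℂ) :=
  Submodule.span F {f | ∃ w : ColoredWord, (∀ l ∈ w, l.2 ∈ F ∧ l.2 ≠ 0) ∧ f = multipleHarmonic w}

lemma multipleHarmonic_eq_zero {w : ColoredWord} (h : ∃ l ∈ w, l.2 = 0) :
    multipleHarmonic w = 0 := by
  induction w with
  | nil => simp at h
  | cons l w ih =>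
    obtain ⟨r, s⟩ := l
    ext N
    rw [multipleHarmonic]
    refine Finset.sum_eq_zero fun k _ => ?_
    obtain ⟨l, hl, h0⟩ := h
    rcases List.mem_cons.1 hl with rfl | hl
    · simp only at h0
      simp [h0]
    · simp [ih ⟨l, hl, h0⟩]

lemma multipleHarmonic_mem_harmonicSpan {w : ColoredWord} (hw : ∀ l ∈ w, l.2 ∈ F) :
    multipleHarmonic w ∈ harmonicSpan F := by
  by_cases h : ∃ l ∈ w, l.2 = 0
  · rw [multipleHarmonic_eq_zero h]
    exact zero_mem _
  · push Not at h
    exact Submodule.subset_span ⟨w, fun l hl => ⟨hw l hl, h l hl⟩, rfl⟩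

variable (F) in
/-- By the stuffle product, `harmonicSpan` is an algebra under the pointwise product. -/
noncomputable def harmonicAlgebra : Subalgebra F (ℕ → ℂ) :=
  (harmonicSpan F).toSubalgebra
    (Submodule.subset_span ⟨[], by simp, by ext; simp [multipleHarmonic]⟩) fun f g hf hg => by
      have h := Submodule.mul_mem_mul hf hg
      rw [harmonicSpan, Submodule.span_mul_span] at h
      refine Submodule.span_le.2 ?_ h
      rintro _ ⟨_, ⟨u, hu, rfl⟩, _, ⟨v, hv, rfl⟩, rfl⟩
      have e : multipleHarmonic u * multipleHarmonic v =
          ((stuffle u v).map multipleHarmonic).sum := by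
        ext N
        rw [Pi.mul_apply, multipleHarmonic_mul]
        simpa [Function.comp_def] using (map_list_sum (Pi.evalAddMonoidHom (fun _ : ℕ => ℂ) N)
          ((stuffle u v).map multipleHarmonic)).symm
      simp only [e]
      refine list_sum_mem ?_
      intro f hf
      obtain ⟨w, hw, rfl⟩ := List.mem_map.1 hf
      exact multipleHarmonic_mem_harmonicSpan (colors_stuffle (P := (· ∈ F))
        (fun _ _ => F.mul_mem) (fun l hl => (hu l hl).1) (fun l hl => (hv l hl).1) w hw)

lemma harmonicProduct_mem {m : ℕ} {α : Fin m → ColoredWord} (hα : ∀ j, ∀ l ∈ α j, l.2 ∈ F)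
    (e : Fin m → ℕ) : harmonicProduct α e ∈ harmonicSpan F := by
  have h : harmonicProduct α e = ∏ j, multipleHarmonic (α j) ^ e j := by
    ext N
    simp [harmonicProduct]
  rw [h]
  exact (harmonicAlgebra F).prod_mem fun j _ =>
    (harmonicAlgebra F).pow_mem (multipleHarmonic_mem_harmonicSpan (hα j)) (e j)

/-! ### Arithmetic progressions and roots of unity -/

lemma exists_sum_pow_eq (hroot : ∀ x ∈ F, ∀ n : ℕ, 0 < n → ∀ y : ℂ, y ^ n = x → y ∈ F) {s : ℂ}
    (hs : s ∈ F) (hs0 : s ≠ 0) {a : ℕ} (ha : 0 < a) :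
    ∃ c : ℕ → ℂ, (∀ j, c j ∈ F ∧ c j ≠ 0) ∧ ∀ n,
      ∑ j ∈ Finset.range a, c j ^ n = if a ∣ n then a * s ^ (n / a) else 0 := by
  obtain ⟨σ, hσ⟩ := IsAlgClosed.exists_pow_nat_eq s ha
  have hζ := Complex.isPrimitiveRoot_exp a ha.ne'
  set ζ := Complex.exp (2 * Real.pi * Complex.I / a)
  have hσF : σ ∈ F := hroot s hs a ha σ hσ
  have hζF : ζ ∈ F := hroot 1 F.one_mem a ha ζ hζ.pow_eq_one
  have hσ0 : σ ≠ 0 := by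
    rintro rfl
    rw [zero_pow ha.ne'] at hσ
    exact hs0 hσ.symm
  refine ⟨fun j => σ * ζ ^ j, fun j => ⟨F.mul_mem hσF (F.pow_mem hζF j),
    mul_ne_zero hσ0 (pow_ne_zero _ (hζ.ne_zero ha.ne'))⟩, fun n => ?_⟩
  have e : ∑ j ∈ Finset.range a, (σ * ζ ^ j) ^ n =
      σ ^ n * ∑ j ∈ Finset.range a, (ζ ^ n) ^ j := by
    rw [Finset.mul_sum]
    refine Finset.sum_congr rfl fun j _ => ?_
    rw [mul_pow, ← pow_mul, ← pow_mul, mul_comm j n]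
  rw [e]
  split_ifs with h
  · obtain ⟨k, rfl⟩ := h
    rw [pow_mul, hσ, pow_mul, hζ.pow_eq_one, Nat.mul_div_cancel_left k ha]
    simp [mul_comm]
  · have h1 : ζ ^ n - 1 ≠ 0 := sub_ne_zero.2 fun h' => h ((hζ.pow_eq_one_iff_dvd n).1 h')
    have h2 : (ζ ^ n - 1) * ∑ j ∈ Finset.range a, (ζ ^ n) ^ j = 0 := by
      rw [mul_geom_sum, ← pow_mul, mul_comm n a, pow_mul, hζ.pow_eq_one, one_pow, sub_self]
    rw [(mul_eq_zero.1 h2).resolve_left h1, mul_zero]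

variable (F) in
/-- The summation operator that puts the letter `(r, σ)` in front of a word. -/
noncomputable def consLetter (r : ℕ+) (σ : ℂ) : (ℕ → ℂ) →ₗ[F] (ℕ → ℂ) where
  toFun g N := ∑ k ∈ Finset.range N, σ ^ (k + 1) / ((k + 1 : ℕ) : ℂ) ^ (r : ℕ) * g k
  map_add' f g := by
    ext N
    simp [mul_add, Finset.sum_add_distrib]
  map_smul' c f := by
    ext N
    simp only [Pi.smul_apply, RingHom.id_apply, Subfield.smul_def, smul_eq_mul, Finset.mul_sum]
    exact Finset.sum_congr rfl fun k _ => mul_left_comm _ _ _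

lemma consLetter_mem {r : ℕ+} {σ : ℂ} (hσ : σ ∈ F) {g : ℕ → ℂ} (hg : g ∈ harmonicSpan F) :
    consLetter F r σ g ∈ harmonicSpan F := by
  have : harmonicSpan F ≤ (harmonicSpan F).comap (consLetter F r σ) := by
    refine Submodule.span_le.2 ?_
    rintro _ ⟨w, hw, rfl⟩
    have h : multipleHarmonic ((r, σ) :: w) ∈ harmonicSpan F :=
      multipleHarmonic_mem_harmonicSpan (List.forall_mem_cons.2 ⟨hσ, fun l hl => (hw l hl).1⟩)
    exact h
  exact this hg

/-- Harmonic numbers of index `N / a` are harmonic numbers of index `N`: the summation indices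
become multiples of `a`, which are selected by `a`-th roots. -/
lemma dilate_mem_harmonicSpan
    (hroot : ∀ x ∈ F, ∀ n : ℕ, 0 < n → ∀ y : ℂ, y ^ n = x → y ∈ F) {a : ℕ} (ha : 0 < a)
    {f : ℕ → ℂ} (hf : f ∈ harmonicSpan F) : (fun N => f (N / a)) ∈ harmonicSpan F := by
  have ha0 : (a : ℂ) ≠ 0 := by exact_mod_cast ha.ne'
  have key : ∀ w : ColoredWord, (∀ l ∈ w, l.2 ∈ F ∧ l.2 ≠ 0) →
      (fun N => multipleHarmonic w (N / a)) ∈ harmonicSpan F := by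
    intro w
    induction w with
    | nil => exact fun hw => Submodule.subset_span ⟨[], hw, rfl⟩
    | cons l w ih =>
      intro hw
      obtain ⟨r, s⟩ := l
      obtain ⟨hs, hs0⟩ := hw _ List.mem_cons_self
      have ih' := ih fun l hl => hw l (List.mem_cons_of_mem _ hl)
      obtain ⟨c, hc, hcs⟩ := exists_sum_pow_eq hroot hs hs0 ha
      have hmem : ((a : F) ^ (r : ℕ) * (a : F)⁻¹) • ∑ j ∈ Finset.range a,
          consLetter F r (c j) (fun N => multipleHarmonic w (N / a)) ∈ harmonicSpan F :=
        Submodule.smul_mem _ _ (sum_mem fun j _ => consLetter_mem (hc j).1 ih')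
      convert hmem using 1
      ext N
      rw [Pi.smul_apply, Finset.sum_apply, Subfield.smul_def, smul_eq_mul]
      simp only [consLetter, LinearMap.coe_mk, AddHom.coe_mk]
      rw [Finset.sum_comm, Finset.mul_sum]
      simp only [← Finset.sum_mul, ← Finset.sum_div, hcs]
      induction N with
      | zero => simp [multipleHarmonic]
      | succ N ihN =>
        rw [Finset.sum_range_succ, ← ihN, Nat.succ_div]
        split_ifs with h
        · obtain ⟨k, hk⟩ := h
          have hk0 : 0 < k := Nat.pos_of_ne_zero (by rintro rfl; simp at hk)
          have hNa : N / a = k - 1 := by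
            have : (N + 1) / a = N / a + 1 := by rw [Nat.succ_div, if_pos ⟨k, hk⟩]
            rw [hk, Nat.mul_div_cancel_left k ha] at this
            omega
          rw [multipleHarmonic, Finset.sum_range_succ, ← multipleHarmonic, hNa,
            Nat.sub_add_cancel hk0, hk]
          have hk0' : (k : ℂ) ≠ 0 := by exact_mod_cast hk0.ne'
          push_cast
          rw [mul_pow]
          field_simp
        · simp
  induction hf using Submodule.span_induction with
  | mem f hf =>
    obtain ⟨w, hw, rfl⟩ := hf
    exact key w hw
  | zero => exact zero_mem _
  | add f g _ _ hf hg => exact add_mem hf hg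
  | smul c f _ hf => exact Submodule.smul_mem _ c hf

lemma divIndex_shiftSeq_pow_mul_mem {σ : ℂ} (hσ : σ ∈ F) (hσ0 : σ ≠ 0) (B : ℕ) {f : ℕ → ℂ}
    (hf : f ∈ harmonicSpan F) :
    divIndex F (shiftSeq F (B + 1) fun n => σ ^ n * f n) ∈ hyperSeqSpan F := by
  induction hf using Submodule.span_induction with
  | mem f hf =>
    obtain ⟨w, hw, rfl⟩ := hf
    have hletters : ∀ (w : ColoredWord) (t : ℂ), (∀ l ∈ w, l.2 ∈ F ∧ l.2 ≠ 0) → t ∈ F →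
        t ≠ 0 → ∀ l ∈ prefixWord t w, l.2 ∈ F ∧ l.2 ≠ 0 := by
      intro w
      induction w with
      | nil => simp [prefixWord]
      | cons l w ih =>
        intro t hw ht ht0
        obtain ⟨r, s⟩ := l
        obtain ⟨hs, hs0⟩ := hw _ List.mem_cons_self
        exact List.forall_mem_cons.2 ⟨⟨F.mul_mem ht hs, mul_ne_zero ht0 hs0⟩,
          ih _ (fun l hl => hw l (List.mem_cons_of_mem _ hl)) (F.mul_mem ht hs)
            (mul_ne_zero ht0 hs0)⟩
    have hv := hletters w σ hw hσ hσ0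
    have e : (shiftSeq F (B + 1) fun n => σ ^ n * multipleHarmonic w n) =
        (⟨σ⁻¹, F.inv_mem hσ⟩ : F) •
          shiftSeq F B fun n => n * hyperCoeff ((0, σ) :: prefixWord σ w) n := by
      ext n
      simp only [Pi.smul_apply, Subfield.smul_def, smul_eq_mul, shiftSeq_apply]
      rcases lt_trichotomy n B with hn | rfl | hn
      · rw [if_neg (by omega), if_neg (by omega), mul_zero]
      · simp
      · obtain ⟨i, rfl⟩ := Nat.exists_eq_add_of_le hn
        rw [if_pos (by omega), if_pos (by omega), show B.succ + i - (B + 1) = i by omega,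
          show B.succ + i - B = i + 1 by omega, ← mul_multipleHarmonic_eq_sum, pow_succ']
        field_simp
    rw [e, map_smul]
    exact Submodule.smul_mem _ _ (divIndex_shiftSeq_mem_aux
      (List.forall_mem_cons.2 ⟨⟨hσ, hσ0⟩, hv⟩) (fun m => divIndex_shiftSeq_mem hv m) B)
  | zero =>
    have e : (fun n => σ ^ n * (0 : ℕ → ℂ) n) = 0 := funext fun n => mul_zero _
    rw [e, map_zero, map_zero]
    exact zero_mem _
  | add f g _ _ hf hg =>
    have e : (fun n => σ ^ n * (f + g) n) = (fun n => σ ^ n * f n) + fun n => σ ^ n * g n :=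
      funext fun n => mul_add _ _ _
    rw [e, map_add, map_add]
    exact add_mem hf hg
  | smul c f _ hf =>
    have e : (fun n => σ ^ n * (c • f) n) = c • fun n => σ ^ n * f n :=
      funext fun n => mul_left_comm _ _ _
    rw [e, map_smul, map_smul]
    exact Submodule.smul_mem _ _ hf

/-- The sequence supported on the progression `k = P n + B` with values `t n`. -/
noncomputable def spreadSeq (P B : ℕ) (t : ℕ → ℂ) (k : ℕ) : ℂ :=
  if B ≤ k ∧ P ∣ k - B then t ((k - B) / P) else 0

lemma sum_spreadSeq {P : ℕ} (hP : 0 < P) (B : ℕ) (t : ℕ → ℂ) (N : ℕ) :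
    ∑ k ∈ Finset.range N, spreadSeq P B t k = ∑ n ∈ Finset.range ((N + P - 1 - B) / P), t n := by
  induction N with
  | zero =>
    rw [Nat.div_eq_of_lt (by omega)]
    simp
  | succ N ih =>
    rw [Finset.sum_range_succ, ih, spreadSeq]
    by_cases hB : B ≤ N
    · obtain ⟨i, rfl⟩ := Nat.exists_eq_add_of_le hB
      rw [show B + i + 1 + P - 1 - B = (i + P - 1) + 1 by omega,
        show B + i + P - 1 - B = i + P - 1 by omega, show B + i - B = i by omega, Nat.succ_div,
        show i + P - 1 + 1 = i + P by omega]
      have hdvd : P ∣ i + P ↔ P ∣ i := (Nat.dvd_add_left (dvd_refl P))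
      simp only [hdvd, hB, true_and]
      split_ifs with h
      · obtain ⟨k, rfl⟩ := h
        have h1 : (P * k + P - 1) / P = k := by
          rw [show P * k + P - 1 = P * k + (P - 1) by omega, Nat.mul_add_div hP,
            Nat.div_eq_of_lt (by omega), add_zero]
        rw [h1, Nat.mul_div_cancel_left k hP, Finset.sum_range_succ]
      · simp
    · rw [if_neg (fun h => hB h.1), add_zero, Nat.div_eq_of_lt (by omega),
        Nat.div_eq_of_lt (by omega)]

lemma tendsto_sum_spreadSeq {P : ℕ} (hP : 0 < P) (B : ℕ) {t : ℕ → ℂ} {S : ℂ}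
    (h : Tendsto (fun N => ∑ n ∈ Finset.range N, t n) atTop (𝓝 S)) :
    Tendsto (fun N => ∑ k ∈ Finset.range N, spreadSeq P B t k) atTop (𝓝 S) := by
  simp only [sum_spreadSeq hP]
  refine h.comp (tendsto_atTop.2 fun M => ?_)
  filter_upwards [eventually_ge_atTop (P * M + B)] with N hN
  rw [Nat.le_div_iff_mul_le hP, mul_comm]
  omega

/-- The terms `z ^ n A (p n) / (a n + b) ^ q`, placed at the indices `a p n + b p`, form a
combination of hyperlogarithm coefficient sequences. -/
theorem spreadSeq_mem_hyperSeqSpan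
    (hroot : ∀ x ∈ F, ∀ n : ℕ, 0 < n → ∀ y : ℂ, y ^ n = x → y ∈ F) {p a b q : ℕ} (hp : 0 < p)
    (ha : 0 < a) (hb : 0 < b) (hq : 0 < q) {z : ℂ} (hz : z ∈ F) (hz0 : z ≠ 0) {f : ℕ → ℂ}
    (hf : f ∈ harmonicSpan F) :
    spreadSeq (a * p) (b * p) (fun n => z ^ n * f (p * n) / ((a : ℂ) * n + b) ^ q) ∈
      hyperSeqSpan F := by
  obtain ⟨c, hc, hcs⟩ := exists_sum_pow_eq hroot hz hz0 (Nat.mul_pos ha hp)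
  obtain ⟨B, hB⟩ := Nat.exists_eq_succ_of_ne_zero (Nat.mul_pos hb hp).ne'
  obtain ⟨q, rfl⟩ := Nat.exists_eq_succ_of_ne_zero hq.ne'
  have hf' := dilate_mem_harmonicSpan hroot ha hf
  -- `E` is supported on the multiples of `a * p`, with value `a * p * z ^ n * f (p * n)` at
  -- `a * p * n`
  set E : ℕ → ℂ := ∑ j ∈ Finset.range (a * p), fun n => c j ^ n * f (n / a) with hE
  have hD : divIndex F (shiftSeq F (B + 1) E) ∈ hyperSeqSpan F := by
    rw [hE, map_sum, map_sum]
    exact sum_mem fun j _ => divIndex_shiftSeq_pow_mul_mem (hc j).1 (hc j).2 B hf'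
  have hmem := Submodule.smul_mem _ ((p : F) ^ (q + 1) * ((a * p : ℕ) : F)⁻¹)
    (iterate_divIndex_mem hD q)
  convert hmem using 1
  ext k
  rw [Pi.smul_apply, Subfield.smul_def, smul_eq_mul, iterate_divIndex_apply, shiftSeq_apply,
    spreadSeq, hB]
  by_cases hk : B + 1 ≤ k
  swap
  · rw [if_neg (fun h => hk h.1), if_neg hk]
    simp
  have hEk : E (k - (B + 1)) = (if a * p ∣ k - (B + 1) then
      ((a * p : ℕ) : ℂ) * z ^ ((k - (B + 1)) / (a * p)) else 0) * f ((k - (B + 1)) / a) := by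
    rw [hE, Finset.sum_apply, ← Finset.sum_mul, hcs]
  rw [if_pos hk, Nat.succ_eq_add_one, hEk]
  simp only [hk, true_and]
  split_ifs with h
  · obtain ⟨n, hn⟩ := h
    have hkn : k = p * (a * n + b) := by
      have : k = a * p * n + b * p := by rw [hB, ← hn]; omega
      rw [this]
      ring
    rw [hn, Nat.mul_div_cancel_left n (Nat.mul_pos ha hp), hkn,
      show a * p * n / a = p * n by rw [mul_assoc, Nat.mul_div_cancel_left _ ha]]
    have h1 : (p : ℂ) ≠ 0 := by exact_mod_cast hp.ne'
    have h2 : (a : ℂ) ≠ 0 := by exact_mod_cast ha.ne'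
    have h3 : (a : ℂ) * n + b ≠ 0 := by exact_mod_cast (by omega : a * n + b ≠ 0)
    push_cast
    rw [mul_pow]
    field_simp
  · simp

end Sequences

/-! ### Assembling the series -/

section Assembly

variable {R : Subring ℂ} {F : Subfield ℂ}

lemma polySpan_hyperModule_mono {A B : Set ℂ} (hAB : A ⊆ B) (c : ℂ) :
    polySpan (hyperModule R A c) ≤ polySpan (hyperModule R B c) := by
  refine Submodule.span_mono ?_
  rintro _ ⟨m, g, hg, rfl⟩
  refine ⟨m, g, Submodule.span_mono ?_ hg, rfl⟩
  rintro _ ⟨v, hv, rfl⟩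
  exact ⟨v, hv.mono hAB, rfl⟩

lemma exists_generatingFunction (hF : ∀ x ∈ F, x ∈ R) {G : ℕ → ℂ} (hG : G ∈ hyperSeqSpan F) :
    ∃ A : Set ℂ, A.Finite ∧ A ⊆ F ∧ (1 : ℂ) ∈ A ∧ ∃ g ∈ polySpan (hyperModule R A 0),
      ∀ᶠ x in 𝓝 0, HasSum (fun n => G n * x ^ n) (g x) := by
  induction hG using Submodule.span_induction with
  | mem G hG =>
    obtain ⟨m, v, hv, rfl⟩ := hG
    refine ⟨{0, 1} ∪ (fun l : ℕ × ℂ => l.2⁻¹) '' {l | l ∈ v}, ?_, ?_, by simp,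
      fun x => x ^ m * hyperlog v (x - 0), Submodule.subset_span ⟨m, _,
        hyperlog_mem_hyperModule ?_, rfl⟩, ?_⟩
    · exact (Set.toFinite _).union (v.finite_toSet.image _)
    · rintro _ (h | ⟨l, hl, rfl⟩)
      · rcases h with rfl | rfl
        · exact F.zero_mem
        · exact F.one_mem
      · exact F.inv_mem (hv l hl).1
    · exact fun l hl => ⟨(hv l hl).2, Or.inr ⟨l, hl, (zero_add _).symm⟩, Or.inr (by simp)⟩
    · obtain ⟨ρ, hρ, hvρ⟩ := exists_radius (v := v) (u := 0) (by simp)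
      rw [norm_zero] at hρ
      filter_upwards [Metric.ball_mem_nhds (0 : ℂ) hρ] with x hx
      rw [mem_ball_zero_iff] at hx
      have hs := (hasSum_hyperlog (u := x) fun l hl =>
        (mul_le_mul_of_nonneg_left hx.le (norm_nonneg _)).trans_lt (hvρ l hl)).mul_left (x ^ m)
      rw [sub_zero]
      refine (hasSum_nat_add_iff' m).1 ?_
      rw [Finset.sum_eq_zero, sub_zero]
      · refine hasSum_of_forall_eq hs fun n => ?_
        rw [shiftSeq_apply, if_pos (Nat.le_add_left m n), Nat.add_sub_cancel, pow_add]
        ring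
      · intro n hn
        rw [shiftSeq_apply, if_neg (by simpa using hn), zero_mul]
  | zero =>
    refine ⟨{1}, Set.finite_singleton 1, by simp, rfl, 0, zero_mem _,
      Eventually.of_forall fun x => ?_⟩
    simp
  | add G₁ G₂ _ _ h₁ h₂ =>
    obtain ⟨A₁, hA₁, hF₁, h1, g₁, hg₁, hs₁⟩ := h₁
    obtain ⟨A₂, hA₂, hF₂, -, g₂, hg₂, hs₂⟩ := h₂
    refine ⟨A₁ ∪ A₂, hA₁.union hA₂, Set.union_subset hF₁ hF₂, Or.inl h1, g₁ + g₂,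
      add_mem (polySpan_hyperModule_mono Set.subset_union_left 0 hg₁)
        (polySpan_hyperModule_mono Set.subset_union_right 0 hg₂), ?_⟩
    filter_upwards [hs₁, hs₂] with x hx₁ hx₂
    exact hasSum_of_forall_eq (hx₁.add hx₂) fun n => add_mul _ _ _
  | smul c G _ h =>
    obtain ⟨A, hA, hAF, h1, g, hg, hs⟩ := h
    refine ⟨A, hA, hAF, h1, _, Submodule.smul_mem _ (⟨c, hF c c.2⟩ : R) hg, ?_⟩
    filter_upwards [hs] with x hx
    exact hasSum_of_forall_eq (hx.mul_left (c : ℂ)) fun n => mul_assoc _ _ _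

lemma dense_of_I_mem (hI : Complex.I ∈ F) : Dense (F : Set ℂ) := by
  intro x
  rw [Metric.mem_closure_iff]
  intro ε hε
  obtain ⟨q₁, h₁, h₁'⟩ := exists_rat_btwn (show x.re < x.re + ε / 2 by linarith)
  obtain ⟨q₂, h₂, h₂'⟩ := exists_rat_btwn (show x.im < x.im + ε / 2 by linarith)
  refine ⟨q₁ + q₂ * Complex.I, F.add_mem (SubfieldClass.ratCast_mem F q₁)
    (F.mul_mem (SubfieldClass.ratCast_mem F q₂) hI), ?_⟩
  rw [dist_eq_norm]
  have e₁ : |(x - (q₁ + q₂ * Complex.I)).re| < ε / 2 := by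
    rw [show (x - (q₁ + q₂ * Complex.I)).re = x.re - q₁ by simp, abs_lt]
    constructor <;> linarith
  have e₂ : |(x - (q₁ + q₂ * Complex.I)).im| < ε / 2 := by
    rw [show (x - (q₁ + q₂ * Complex.I)).im = x.im - q₂ by simp, abs_lt]
    constructor <;> linarith
  exact (Complex.norm_le_abs_re_add_abs_im _).trans_lt (by linarith)

/-- If `F` contains all roots of its elements, the sum of the series is an `F`-linear combination
of strictly convergent values with colours in `F`. -/
theorem sum_mem_span_strictValues
    (hroot : ∀ x ∈ F, ∀ n : ℕ, 0 < n → ∀ y : ℂ, y ^ n = x → y ∈ F) {p a b q : ℕ} (hp : 0 < p)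
    (ha : 0 < a) (hb : 0 < b) (hq : 0 < q) {z : ℂ} (hz : z ∈ F) {m : ℕ}
    {α : Fin m → ColoredWord} (hα : ∀ j, ∀ l ∈ α j, l.2 ∈ F) (e : Fin m → ℕ) {S : ℂ}
    (hS : Tendsto
      (fun N : ℕ => ∑ n ∈ Finset.Icc 1 N,
        z ^ n * harmonicProduct α e (p * n) / ((a : ℂ) * (n : ℂ) + (b : ℂ)) ^ q)
      atTop (𝓝 S)) : S ∈ Submodule.span F (strictValues F) := by
  rw [← mem_strictRing]
  set R : Subring ℂ := (strictRing F).toSubring with hRdef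
  change S ∈ R
  have hF : ∀ x ∈ F, x ∈ R := fun x hx => (strictRing F).algebraMap_mem ⟨x, hx⟩
  have hR : ContainsHyperlogValues R F := fun v u hv hu huv => hyperlog_mem_strictRing hv hu huv
  -- for `z = 0` every term vanishes; afterwards `z` has nonzero roots
  by_cases hz0 : z = 0
  · have h0 : Tendsto (fun N : ℕ => ∑ n ∈ Finset.Icc 1 N,
        z ^ n * harmonicProduct α e (p * n) / ((a : ℂ) * (n : ℂ) + (b : ℂ)) ^ q)
        atTop (𝓝 0) := by
      refine tendsto_const_nhds.congr fun N => (Finset.sum_eq_zero fun n hn => ?_).symm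
      rw [hz0, zero_pow (by have := (Finset.mem_Icc.1 hn).1; omega), zero_mul, zero_div]
    rw [tendsto_nhds_unique hS h0]
    exact R.zero_mem
  set t : ℕ → ℂ := fun n => z ^ n * harmonicProduct α e (p * n) / ((a : ℂ) * n + b) ^ q with ht
  -- the progression of indices starts at `n = 0`, so this term is added and subtracted
  have ht0 : t 0 ∈ R := by
    refine hF _ (F.div_mem (F.mul_mem (F.pow_mem hz 0) (F.prod_mem fun j _ =>
      F.pow_mem ?_ _)) (F.pow_mem (F.add_mem (F.mul_mem (natCast_mem F a) ?_)
        (natCast_mem F b)) q))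
    · cases α j with
      | nil => simp [multipleHarmonic]
      | cons l w => simp [multipleHarmonic]
    · exact natCast_mem F 0
  have hlim : Tendsto (fun N => ∑ n ∈ Finset.range N, t n) atTop (𝓝 (t 0 + S)) := by
    rw [← tendsto_add_atTop_iff_nat 1]
    refine (hS.const_add (t 0)).congr fun N => ?_
    rw [Finset.range_eq_Ico, Finset.sum_eq_sum_Ico_succ_bot (Nat.succ_pos N)]
    rfl
  have hG := spreadSeq_mem_hyperSeqSpan hroot hp ha hb hq hz hz0 (harmonicProduct_mem hα e)
  obtain ⟨A, hA, hAF, h1A, g, hg, hGg⟩ := exists_generatingFunction hF hG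
  have hI : Complex.I ∈ F := hroot (-1) (F.neg_mem F.one_mem) 2 two_pos _ Complex.I_sq
  have hmem := mem_of_tendsto_sum hA hAF h1A (dense_of_I_mem hI) hF hR hg hGg
    (tendsto_sum_spreadSeq (Nat.mul_pos ha hp) (b * p) hlim)
  have := R.sub_mem hmem ht0
  rwa [add_sub_cancel_left] at this

end Assembly

theorem mainTheorem12 (p a b q : ℕ) (hp : 1 ≤ p) (ha : 1 ≤ a) (hb : 1 ≤ b) (hq : 1 ≤ q)
    (z : ℂ) (m : ℕ) (α : Fin m → ColoredWord) (e : Fin m → ℕ) (S : ℂ)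
    (hS : Tendsto
      (fun N : ℕ => ∑ n ∈ Finset.Icc 1 N,
        z ^ n * harmonicProduct α e (p * n) / ((a : ℂ) * (n : ℂ) + (b : ℂ)) ^ q)
      atTop (𝓝 S)) :
    ∃ (L : ℕ) (c : Fin L → ℂ) (β : Fin L → ColoredWord) (v : Fin L → ℂ),
      (∀ i, IsMultiplePolylogValue (β i) (v i)) ∧
      S = ∑ i, c i * v i ∧
      (∀ i, IsAlgebraic (parameterField z α) (c i)) ∧
      (∀ i, ∀ l ∈ β i, IsAlgebraic (parameterField z α) l.2) ∧
      ((IsAlgebraic ℚ z ∧ ∀ j, ∀ l ∈ α j, IsAlgebraic ℚ l.2) →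
        (∀ i, IsAlgebraic ℚ (c i)) ∧ (∀ i, ∀ l ∈ β i, IsAlgebraic ℚ l.2)) := by
  set F : Subfield ℂ := (algebraicClosure (parameterField z α) ℂ).toSubfield with hFdef
  have hmemF : ∀ x : ℂ, x ∈ F ↔ IsAlgebraic (parameterField z α) x := fun x =>
    mem_algebraicClosure_iff
  have hK : ∀ x ∈ parameterField z α, x ∈ F := fun x hx =>
    (hmemF x).2 (isAlgebraic_algebraMap (⟨x, hx⟩ : parameterField z α))
  have hroot : ∀ x ∈ F, ∀ n : ℕ, 0 < n → ∀ y : ℂ, y ^ n = x → y ∈ F := by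
    rintro x hx n hn y rfl
    exact (hmemF y).2 (((hmemF _).1 hx).of_pow hn)
  have hz : z ∈ F := hK z (IntermediateField.subset_adjoin ℚ _ (Or.inl rfl))
  have hα : ∀ j, ∀ l ∈ α j, l.2 ∈ F := fun j l hl =>
    hK _ (IntermediateField.subset_adjoin ℚ _ (Or.inr ⟨j, l, hl, rfl⟩))
  have hmem := sum_mem_span_strictValues hroot hp ha hb hq hz hα e hS
  obtain ⟨L, c, v, hv⟩ := Submodule.mem_span_set'.1 hmem
  choose β hβF _ hβv using fun i => (v i).2
  have hc : ∀ i, IsAlgebraic (parameterField z α) (c i : ℂ) := fun i => (hmemF _).1 (c i).2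
  have hβ : ∀ i, ∀ l ∈ β i, IsAlgebraic (parameterField z α) l.2 := fun i l hl =>
    (hmemF _).1 (hβF i l hl)
  refine ⟨L, fun i => c i, β, fun i => v i, hβv, hv.symm, hc, hβ, ?_⟩
  rintro ⟨hz', hα'⟩
  have halg : Algebra.IsAlgebraic ℚ (parameterField z α) := by
    refine IntermediateField.isAlgebraic_adjoin ?_
    rintro x (rfl | ⟨j, l, hl, rfl⟩)
    · exact hz'.isIntegral
    · exact (hα' j l hl).isIntegral
  exact ⟨fun i => (hc i).restrictScalars ℚ, fun i l hl => (hβ i l hl).restrictScalars ℚ⟩
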